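/- Let $A$ be a quantum system with Hilbert space $\mathcal H_A$ of finite dimension $d$, and let $A'$ be a system with nonzero Hilbert space $\mathcal H_{A'}$ of arbitrary dimension. A \emph{test} consists of a reference system $R$ (of arbitrary dimension), a density operator $\sigma_{AR}$ on $\mathcal H_A\otimes\mathcal H_R$ and a bounded self-adjoint operator $O$ on $\mathcal H_{A'}\otimes\mathcal H_R$. Its \emph{performance operator} is $\Omega=\operatorname{Tr}_R[(O_{A'R}\otimes I_A)(I_{A'}\otimes\sigma_{AR})]$, an operator on $\mathcal H_{A'}\otimes\mathcal H_A$, and its marginal input state is $\sigma_A=\operatorname{Tr}_R[\sigma_{AR}]$. A device $\mathcal C$ from $A$ to $A'$ has the score $S^{\rm det}(\mathcal C)=\operatorname{Tr}[O\,(\mathcal C\otimes\mathcal I_R)(\sigma_{AR})]$ if it is deterministic (a channel), and in the probabilistic case (a quantum operation) it has the success probability $p_{\rm succ}(\mathcal C)=\operatorname{Tr}[\mathcal C(\sigma_A)]$ and, if this is positive, the score $S^{\rm prob}(\mathcal C)=\operatorname{Tr}[O\,(\mathcal C\otimes\mathcal I_R)(\sigma_{AR})]/p_{\rm succ}(\mathcal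 C)$. A \emph{measure-and-prepare} channel (respectively quantum operation) is a map $\mathcal C(\rho)=\sum_k\operatorname{Tr}[P_k\rho]\,\rho_k$ with countably many density operators $\rho_k$ on $\mathcal H_{A'}$ and positive operators $P_k$ on $\mathcal H_A$ such that $\sum_kP_k=I_A$ (respectively $\sum_kP_k\le I_A$). The \emph{deterministic benchmark} $S^{\rm det}_{\rm M\&P}$ of a test is the supremum of $S^{\rm det}(\mathcal C)$ over all measure-and-prepare channels; its \emph{probabilistic benchmark at success probability} $p\in(0,1]$ is the supremum of $S^{\rm prob}(\mathcal C)$ over all measure-and-prepare quantum operations with $p_{\rm succ}(\mathcal C)=p$. A test is \emph{fully black box} if its deterministic benchmark and its probabilistic benchmarks at all success probabilities $p\in(0,1]$ have one and the same finite value. Finally, $\Lambda^{\otimes}(\Omega)=\sup\langle\alpha'|\langle\alpha|\,\Omega\,|\alpha'\rangle|\alpha\rangle$, the supremum being over all unit vectors $|\alpha'\rangle\in\mathcal H_{A'}$ and $|\alpha\rangle\in\mathcal H_A$. \textbf{Lemma.} Let $\mathcal T$ be a test whose performance operator $\Omega$ has positive partial transpose, $\Omega^{T_A}\ge0$. Let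 $(U_g)_{g\in G}$ and $(U'_g)_{g\in G}$ be projective unitary representations of a group $G$ on $\mathcal H_A$ and $\mathcal H_{A'}$, such that $[\Omega,U'_g\otimes U_g]=0$ for all $g\in G$ and such that $(U_g)_{g\in G}$ is irreducible (no subspace of $\mathcal H_A$ other than $\{0\}$ and $\mathcal H_A$ is invariant). Then $$S^{\rm det}_{\rm M\&P}=d\,\Lambda^{\otimes}(\Omega),$$ and every test $\mathcal T'$ with performance operator $\Omega$ and marginal input state $\sigma_A=I_A/d$ is fully black box. -/

import Mathlib

/-! Quantum systems are described in a fixed orthonormal basis: the Hilbert space with basis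
labelled by `X` is `ℓ²(X)` (of arbitrary dimension), and the composite of the systems labelled by
`X` and `Y` is `ℓ²(X × Y)`. For the finite-dimensional input system, with basis labelled by a
finite type `n`, operators are matrices `Matrix n n ℂ`. -/

namespace QBenchmark

noncomputable section

open scoped ComplexOrder

/-- The Hilbert space `ℓ²(X)`. -/
abbrev Hil (X : Type*) : Type _ := lp (fun _ : X => ℂ) 2

/-- Bounded operators on `ℓ²(X)`. -/
abbrev Op (X : Type*) : Type _ := Hil X →L[ℂ] Hil X

open Classical in
/-- The matrix elements `⟨p| T |q⟩` of a bounded operator. -/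
def mat {X : Type*} (T : Op X) : Matrix X X ℂ :=
  fun p q => (T (lp.single 2 q (1 : ℂ)) : X → ℂ) p

/-- The trace of a product, `Tr[M N]`, of two (possibly infinite) matrices. -/
def traceMul {X : Type*} (M N : Matrix X X ℂ) : ℂ := ∑' p, ∑' q, M p q * N q p

/-- Density operators: positive operators of trace one. -/
def IsDensity {X : Type*} (T : Op X) : Prop :=
  T.IsPositive ∧ HasSum (fun p => mat T p p) 1

/-- A test with input system `A` (basis `n`), output system `A'` (basis `ι`) and reference
system `R` (basis `κ`): a joint state of `AR` is prepared, `A` is sent through the tested device,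
and a bounded observable is measured on `A'R`. -/
structure Test (n ι κ : Type*) where
  /-- the input state, on `AR` -/
  σ : Op (n × κ)
  σ_density : IsDensity σ
  /-- the measured observable, on `A'R` -/
  O : Op (ι × κ)
  O_selfAdjoint : IsSelfAdjoint O

variable {n ι κ : Type*}

/-- `(C ⊗ id_R)(σ)` in matrix form, for a device `C` from `A` to `A'` and an operator `σ` on
`AR`. -/
def applyLeft (C : Matrix n n ℂ →ₗ[ℂ] Op ι) (σ : Op (n × κ)) : Matrix (ι × κ) (ι × κ) ℂ :=
  fun p q => mat (C (fun a b => mat σ (a, p.2) (b, q.2))) p.1 q.1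

namespace Test

/-- The performance operator `Ω = Tr_R[(O_{A'R} ⊗ I_A)(I_{A'} ⊗ σ_{AR})]`, on `A'A`. -/
def performanceOperator (T : Test n ι κ) : Matrix (ι × n) (ι × n) ℂ :=
  fun p q => ∑' r, ∑' s, mat T.O (p.1, r) (q.1, s) * mat T.σ (p.2, s) (q.2, r)

/-- The marginal input state `σ_A = Tr_R[σ_{AR}]`. -/
def marginal (T : Test n ι κ) : Matrix n n ℂ :=
  fun a b => ∑' r, mat T.σ (a, r) (b, r)

/-- The (unnormalised) score `Tr[O (C ⊗ id_R)(σ)]`; for a channel, this is its score. -/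
def score (T : Test n ι κ) (C : Matrix n n ℂ →ₗ[ℂ] Op ι) : ℝ :=
  (traceMul (mat T.O) (applyLeft C T.σ)).re

/-- The probability `Tr[C(σ_A)]` that the device produces an output. -/
def successProb (T : Test n ι κ) (C : Matrix n n ℂ →ₗ[ℂ] Op ι) : ℝ :=
  (∑' i, mat (C T.marginal) i i).re

/-- The score of a probabilistic device, conditional on the production of an output. -/
def probScore (T : Test n ι κ) (C : Matrix n n ℂ →ₗ[ℂ] Op ι) : ℝ :=
  T.score C / T.successProb C

end Test

/-- `C` measures positive operators `P 0, P 1, …` with sum `E` and, on outcome `k`, prepares the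
state `ρ k`: `C(X) = ∑ₖ Tr[P k X] ρ k`. Finitely many outcomes are the case of `P k = 0` for all
large `k`. -/
def MeasuresAndPrepares [Fintype n] (E : Matrix n n ℂ) (C : Matrix n n ℂ →ₗ[ℂ] Op ι) : Prop :=
  ∃ (P : ℕ → Matrix n n ℂ) (ρ : ℕ → Op ι),
    (∀ k, (P k).PosSemidef) ∧ HasSum P E ∧ (∀ k, IsDensity (ρ k)) ∧
      ∀ X, HasSum (fun k => (P k * X).trace • ρ k) (C X)

/-- Measure-and-prepare channels: `P` is a POVM. -/
def IsMPChannel [Fintype n] [DecidableEq n] (C : Matrix n n ℂ →ₗ[ℂ] Op ι) : Prop :=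
  MeasuresAndPrepares 1 C

/-- Measure-and-prepare quantum operations: the operators of `P` sum up to at most the identity,
so that the device may fail to produce an output. -/
def IsMPOperation [Fintype n] [DecidableEq n] (C : Matrix n n ℂ →ₗ[ℂ] Op ι) : Prop :=
  ∃ E : Matrix n n ℂ, (1 - E).PosSemidef ∧ MeasuresAndPrepares E C

namespace Test

/-- `s` is the deterministic benchmark: the supremum of the scores of all measure-and-prepare
channels. -/
def IsDetBenchmark [Fintype n] [DecidableEq n] (T : Test n ι κ) (s : ℝ) : Prop :=
  IsLUB {x | ∃ C : Matrix n n ℂ →ₗ[ℂ] Op ι, IsMPChannel C ∧ x = T.score C} s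

/-- `s` is the probabilistic benchmark at success probability `p`: the supremum of the scores of
all measure-and-prepare quantum operations that produce an output with probability `p`. -/
def IsProbBenchmark [Fintype n] [DecidableEq n] (T : Test n ι κ) (p s : ℝ) : Prop :=
  IsLUB {x | ∃ C : Matrix n n ℂ →ₗ[ℂ] Op ι,
    IsMPOperation C ∧ T.successProb C = p ∧ x = T.probScore C} s

/-- Fully black box tests: one and the same value is the benchmark for deterministic devices and
for probabilistic devices of every success probability. -/
def IsFullyBlackBox [Fintype n] [DecidableEq n] (T : Test n ι κ) : Prop :=
  ∃ s : ℝ, T.IsDetBenchmark s ∧ ∀ p : ℝ, 0 < p → p ≤ 1 → T.IsProbBenchmark p s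

end Test

/-- The partial transpose on the second factor is positive. -/
def IsPPT (Ω : Matrix (ι × n) (ι × n) ℂ) : Prop :=
  Matrix.PosSemidef (fun p q : ι × n => Ω (p.1, q.2) (q.1, p.2))

/-- `⟨α'|⟨α| Ω |α'⟩|α⟩`, a real number for Hermitian `Ω`. -/
def productExpectation (Ω : Matrix (ι × n) (ι × n) ℂ) (α' : Hil ι) (α : EuclideanSpace ℂ n) : ℝ :=
  (∑' p : ι × n, ∑' q : ι × n, star (α' p.1 * α p.2) * Ω p q * (α' q.1 * α q.2)).re

/-- The (maximum of the) product numerical range, `Λ^⊗(Ω)`. -/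
def productNumericalRange [Fintype n] (Ω : Matrix (ι × n) (ι × n) ℂ) : ℝ :=
  sSup {x | ∃ (α' : Hil ι) (α : EuclideanSpace ℂ n),
    ‖α'‖ = 1 ∧ ‖α‖ = 1 ∧ x = productExpectation Ω α' α}

/-- Projective unitary representations: unitaries that multiply as the group up to phases. -/
def IsProjectiveRep {G B : Type*} [Group G] [Ring B] [StarRing B] [Algebra ℂ B]
    (U : G → unitary B) : Prop :=
  ∀ g h, ∃ c : ℂ, ‖c‖ = 1 ∧ (U g : B) * (U h : B) = c • (U (g * h) : B)

/-- Irreducibility: only the trivial subspace and the whole space are invariant. -/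
def IsIrreducible {G : Type*} [Fintype n] [DecidableEq n]
    (U : G → unitary (Matrix n n ℂ)) : Prop :=
  ∀ W : Submodule ℂ (n → ℂ),
    (∀ g, ∀ v ∈ W, (U g : Matrix n n ℂ).mulVec v ∈ W) → W = ⊥ ∨ W = ⊤

/-- `V ⊗ W` in matrix form. -/
def tensor (V : Op ι) (W : Matrix n n ℂ) : Matrix (ι × n) (ι × n) ℂ :=
  fun p q => mat V p.1 q.1 * W p.2 q.2

/-- Covariance of a performance operator: `[Ω, U'_g ⊗ U_g] = 0` for all `g`. -/
def IsCovariant {G : Type*} [Fintype n] [DecidableEq n] (Ω : Matrix (ι × n) (ι × n) ℂ)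
    (U' : G → unitary (Op ι)) (U : G → unitary (Matrix n n ℂ)) : Prop :=
  ∀ g p q, ∑' r, Ω p r * tensor (U' g : Op ι) (U g : Matrix n n ℂ) r q =
    ∑' r, tensor (U' g : Op ι) (U g : Matrix n n ℂ) p r * Ω r q

end

end QBenchmark

/-!
Write `d` for the dimension of the input system and `Λ` for `productNumericalRange Ω`. The argument
compares scores with the quadratic form `⟨u ⊗ w| Ω |u ⊗ w⟩` (`Test.expect`) on product vectors.

A positive trace-class operator is a sum `∑ₗ |vₗ⟩⟨vₗ|` with `∑ₗ ‖vₗ‖² < ∞` (`IsEnsemble`), so every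
measure-and-prepare device can be refined to the form `C(X) = ∑ⱼ ⟨wⱼ| X |wⱼ⟩ |uⱼ⟩⟨uⱼ|`, with
`∑ⱼ ‖uⱼ‖² ‖wⱼ‖² = Tr E` where `E` is the sum of its measured operators
(`MeasuresAndPrepares.exists_refinement`). Its score on a test with performance operator `Ω` is then
`∑ⱼ ⟨uⱼ ⊗ wⱼ| Ω |uⱼ ⊗ wⱼ⟩` (`Test.hasSum_score`), whence the upper bound `Λ Tr E`, which is `d Λ` for
a channel. The interchanges of infinite sums behind this formula rest on
`tsum_mat_mul_eq_tsum_inner`, the evaluation of `Tr[O ∑ₜ |yₜ⟩⟨xₜ|]` for bounded `O`.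

For the lower bound, fix unit vectors `u` and `w`. By irreducibility, `I / d` lies in the closed
convex hull of the orbit of `|w⟩⟨w|` (`maximallyMixed_mem_closure_convexHull`); the group carries no
invariant mean in general, and the element of least Hilbert–Schmidt norm takes the place of the
average. Hence `(1 + ε) I` is a sum of multiples of `|U_g w⟩⟨U_g w|`, of total weight `d`, and a
positive remainder of trace `ε d` (`exists_resolution`). The channel that measures this resolution
of the identity and prepares `U'_g u` gains `⟨u ⊗ w| Ω |u ⊗ w⟩` per unit of weight, by covariance
(`Test.expect_covariant`), while the remainder changes the score by a multiple of `ε` only, as `Ω`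
is bounded (`exists_channel_score_ge`). Letting `ε → 0` gives `d Λ`.

If the marginal input state is `I / d`, an operation that measures `E` succeeds with probability
`p = Tr E / d`, so its conditional score is at most `Λ Tr E / p = d Λ`; a channel scaled by `p` has
success probability `p` and keeps its score (`Test.IsDetBenchmark.isFullyBlackBox`).
-/

namespace QBenchmark

open scoped ComplexOrder

/-! ### Infinite sums -/

theorem hasSum_prod_of_fiberwise {β γ E : Type*} [NormedAddCommGroup E] [CompleteSpace E]
    {f : β × γ → E} {g : β → E}
    {a : E} (hf : Summable f) (hg : ∀ b, HasSum (fun c => f (b, c)) (g b)) (h : HasSum g a) :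
    HasSum f a := by
  have := hf.hasSum.prod_fiberwise hg
  rw [h.unique this]; exact hf.hasSum

theorem hasSum_prod_of_nonneg {β γ : Type*} {f : β × γ → ℝ} {g : β → ℝ} {a : ℝ}
    (hf : ∀ x, 0 ≤ f x) (hg : ∀ b, HasSum (fun c => f (b, c)) (g b)) (h : HasSum g a) :
    HasSum f a := by
  refine hasSum_prod_of_fiberwise ((summable_prod_of_nonneg hf).2 ⟨fun b => (hg b).summable, ?_⟩)
    hg h
  simpa only [fun b => (hg b).tsum_eq] using h.summable

theorem hasSum_prod_swap {β γ E : Type*} [AddCommMonoid E] [TopologicalSpace E]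
    {f : β × γ → E} {a : E} (hf : HasSum f a) : HasSum (fun x : γ × β => f (x.2, x.1)) a :=
  (Equiv.prodComm γ β).hasSum_iff.2 hf

/-- A sum over a product whose second factor is finite, fibre by fibre: no joint summability has to
be assumed. -/
theorem hasSum_prod_fintype {β γ E : Type*} [Fintype γ] [AddCommMonoid E] [TopologicalSpace E]
    [ContinuousAdd E] {f : β × γ → E} {g : γ → E}
    (hg : ∀ c, HasSum (fun b => f (b, c)) (g c)) : HasSum f (∑ c, g c) := by
  classical
  have h1 : ∀ c, HasSum (fun x : β × γ => if x.2 = c then f x else 0) (g c) := by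
    intro c
    have hinj : Function.Injective (fun b : β => (b, c)) := fun _ _ h => (Prod.ext_iff.1 h).1
    rw [← hinj.hasSum_iff]
    · simpa [Function.comp_def] using hg c
    · rintro ⟨b, c'⟩ hx
      have : c' ≠ c := fun h => hx ⟨b, by rw [h]⟩
      simp [this]
  have h2 := hasSum_sum (s := Finset.univ) (fun c _ => h1 c)
  simpa using h2

/-- The product of two square-summable families is absolutely summable. -/
theorem summable_mul_of_sq {β : Type*} {f g : β → ℂ} (hf : Summable fun b => ‖f b‖ ^ 2)
    (hg : Summable fun b => ‖g b‖ ^ 2) : Summable fun b => f b * g b := by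
  refine Summable.of_norm_bounded (hf.add hg) fun b => ?_
  rw [norm_mul]
  nlinarith [sq_nonneg (‖f b‖ - ‖g b‖), sq_nonneg (‖f b‖), sq_nonneg (‖g b‖)]

/-! ### Matrix elements of bounded operators -/

section

variable {X Y : Type*}

open Classical in
/-- The standard basis vectors of `ℓ²(X)`. -/
noncomputable def ket (p : X) : Hil X := lp.single 2 p (1 : ℂ)

open Classical in
theorem ket_apply (p q : X) : (ket p : X → ℂ) q = if q = p then 1 else 0 := by
  simp [ket, Pi.single_apply]

theorem inner_ket (p : X) (x : Hil X) : inner ℂ (ket p) x = x p := by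
  classical
  simp [ket, lp.inner_single_left]

theorem norm_ket (p : X) : ‖ket p‖ = 1 := by
  classical
  simp [ket, lp.norm_single]

theorem mat_eq_apply (T : Op X) (p q : X) : mat T p q = (T (ket q) : X → ℂ) p := rfl

theorem mat_eq_inner (T : Op X) (p q : X) : mat T p q = inner ℂ (ket p) (T (ket q)) := by
  rw [inner_ket, mat_eq_apply]

theorem hasSum_normSq (x : Hil X) : HasSum (fun p => ‖x p‖ ^ 2) (‖x‖ ^ 2) := by
  simpa using lp.hasSum_norm (p := 2) (by simp) x

theorem hasSum_mul_star (x y : Hil X) : HasSum (fun p => y p * star (x p)) (inner ℂ x y) := by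
  have h := lp.hasSum_inner (𝕜 := ℂ) x y
  simp only [RCLike.inner_apply] at h
  exact h

theorem hasSum_ket (x : Hil X) : HasSum (fun p => x p • ket p) x := by
  classical
  have := lp.hasSum_single (p := 2) (by simp) x
  convert this using 2 with p
  rw [ket, ← lp.single_smul]; simp

theorem adjoint_ket_apply (T : Op X) (p q : X) : (star T (ket p) : X → ℂ) q = star (mat T p q) := by
  rw [← inner_ket, mat_eq_inner, ContinuousLinearMap.star_eq_adjoint,
    ContinuousLinearMap.adjoint_inner_right]
  exact (inner_conj_symm _ _).symm

theorem summable_normSq_mat (T : Op X) (p : X) : Summable fun q => ‖mat T p q‖ ^ 2 := by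
  have := (hasSum_normSq (star T (ket p))).summable
  simpa [adjoint_ket_apply] using this

theorem hasSum_mat_mul (T : Op X) (x : Hil X) (p : X) :
    HasSum (fun q => mat T p q * x q) ((T x) p) := by
  have h := ((innerSL ℂ (ket p)).comp T).hasSum (hasSum_ket x)
  simp only [ContinuousLinearMap.comp_apply, innerSL_apply_apply, inner_ket,
    map_smul, smul_eq_mul] at h
  have h2 : (fun q => mat T p q * x q) = fun q => x q * (T (ket q)) p := by
    funext q
    rw [mat_eq_apply, mul_comm]
  rw [h2]
  exact h

theorem hasSum_mat {β : Type*} {f : β → Op X} {T : Op X} (h : HasSum f T) (p q : X) :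
    HasSum (fun b => mat (f b) p q) (mat T p q) := by
  have := ((innerSL ℂ (ket p)).comp (ContinuousLinearMap.apply ℂ (Hil X) (ket q))).hasSum h
  simpa [Function.comp_def, mat_eq_inner] using this

theorem mat_smul (c : ℂ) (T : Op X) (p q : X) : mat (c • T) p q = c * mat T p q := by
  simp [mat_eq_apply]

theorem mat_sum {β : Type*} (s : Finset β) (f : β → Op X) (p q : X) :
    mat (∑ b ∈ s, f b) p q = ∑ b ∈ s, mat (f b) p q := by
  simp only [mat_eq_inner, sum_apply, inner_sum]

theorem ext_mat {S T : Op X} (h : ∀ p q, mat S p q = mat T p q) : S = T := by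
  ext x p
  refine (hasSum_mat_mul S x p).unique ?_
  simpa only [h] using hasSum_mat_mul T x p

theorem summable_sq_of_norm {β : Type*} {y : β → Hil X} (hy : Summable fun t => ‖y t‖ ^ 2) :
    Summable fun z : β × X => ‖y z.1 z.2‖ ^ 2 :=
  (hasSum_prod_of_nonneg (fun _ => by positivity) (fun t => hasSum_normSq (y t))
    hy.hasSum).summable

theorem summable_sq_apply {β : Type*} {y : β → Hil X} (hy : Summable fun t => ‖y t‖ ^ 2) (p : X) :
    Summable fun t => ‖y t p‖ ^ 2 :=
  Summable.of_nonneg_of_le (fun _ => by positivity)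
    (fun t => le_hasSum (hasSum_normSq (y t)) p fun _ _ => by positivity) hy

/-- The trace `Tr[O N]` of a bounded operator `O` against the trace-class operator
`N = ∑ₜ |yₜ⟩⟨xₜ|`. -/
theorem tsum_mat_mul_eq_tsum_inner {β : Type*} (O : Op X) {x y : β → Hil X} {N : X → X → ℂ}
    (hx : Summable fun t => ‖x t‖ ^ 2) (hy : Summable fun t => ‖y t‖ ^ 2)
    (hN : ∀ q p, HasSum (fun t => y t q * star (x t p)) (N q p)) :
    ∑' p, ∑' q, mat O p q * N q p = ∑' t, inner ℂ (x t) (O (y t)) := by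
  have hy2 := summable_sq_of_norm hy
  have hx2 := summable_sq_of_norm hx
  have inner_eq : ∀ p, ∑' q, mat O p q * N q p = ∑' t, (O (y t)) p * star (x t p) := by
    intro p
    -- Cauchy–Schwarz in the joint index: pair `O p q * star (x t p)` with `y t q`
    have hrow : Summable fun z : β × X => ‖mat O p z.2 * star (x z.1 p)‖ ^ 2 := by
      have := (summable_sq_apply hx p).mul_of_nonneg (summable_normSq_mat O p)
        (fun _ => by positivity) (fun _ => by positivity)
      refine this.congr fun z => ?_
      rw [norm_mul, mul_pow, norm_star, mul_comm]
    have hs := (summable_mul_of_sq hrow hy2)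
    have hs' : Summable (Function.uncurry fun (t : β) (q : X) =>
        mat O p q * (y t q * star (x t p))) := by
      refine hs.congr fun z => ?_
      simp only [Function.uncurry]; ring
    calc ∑' q, mat O p q * N q p
        = ∑' q, ∑' t, mat O p q * (y t q * star (x t p)) := by
          refine tsum_congr fun q => ?_
          rw [tsum_mul_left, (hN q p).tsum_eq]
      _ = ∑' t, ∑' q, mat O p q * (y t q * star (x t p)) := hs'.tsum_comm
      _ = _ := by
          refine tsum_congr fun t => ?_
          rw [← (hasSum_mat_mul O (y t) p).tsum_eq, ← tsum_mul_right]
          simp only [mul_assoc]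
  -- and again, for the pairing of `O (y t)` with `x t` in the joint index `(t, p)`
  have hOy : Summable fun t => ‖O (y t)‖ ^ 2 := by
    refine Summable.of_nonneg_of_le (fun _ => by positivity) (fun t => ?_) (hy.mul_left (‖O‖ ^ 2))
    rw [← mul_pow]
    gcongr
    exact O.le_opNorm _
  have hs : Summable (Function.uncurry fun (t : β) (p : X) => (O (y t)) p * star (x t p)) := by
    have hx3 : Summable fun z : β × X => ‖star (x z.1 z.2)‖ ^ 2 := by
      simpa only [norm_star] using hx2
    exact summable_mul_of_sq (f := fun z : β × X => (O (y z.1)) z.2)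
      (g := fun z : β × X => star (x z.1 z.2)) (summable_sq_of_norm (y := fun t => O (y t)) hOy) hx3
  calc ∑' p, ∑' q, mat O p q * N q p = ∑' p, ∑' t, (O (y t)) p * star (x t p) :=
        tsum_congr inner_eq
    _ = ∑' t, ∑' p, (O (y t)) p * star (x t p) :=
        Summable.tsum_comm (f := fun (t : β) (p : X) => (O (y t)) p * star (x t p)) hs
    _ = _ := tsum_congr fun t => (hasSum_mul_star _ _).tsum_eq

/-- A family of vectors `vₗ` of `ℓ²(X)` with `∑ₗ |vₗ⟩⟨vₗ| = N`. -/
def IsEnsemble {β : Type*} (v : β → Hil X) (N : X → X → ℂ) : Prop :=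
  ∀ q p, HasSum (fun l => v l q * star (v l p)) (N q p)

/-- The squared norms of an ensemble sum up to the trace. -/
theorem IsEnsemble.hasSum_normSq {β : Type*} {v : β → Hil X} {N : X → X → ℂ} {c : ℝ}
    (h : IsEnsemble v N) (htr : HasSum (fun p => N p p) (c : ℂ)) :
    HasSum (fun l => ‖v l‖ ^ 2) c := by
  have hd : ∀ p, HasSum (fun l => ‖v l p‖ ^ 2) (N p p).re := by
    intro p
    have h1 := Complex.hasSum_re (h p p)
    have h2 : (fun l => (v l p * star (v l p)).re) = fun l => ‖v l p‖ ^ 2 := by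
      funext l
      rw [Complex.star_def, Complex.mul_conj, Complex.ofReal_re, Complex.normSq_eq_norm_sq]
    rwa [h2] at h1
  have htr' : HasSum (fun p => (N p p).re) c := by simpa using Complex.hasSum_re htr
  have := hasSum_prod_of_nonneg (f := fun z : X × β => ‖v z.2 z.1‖ ^ 2)
    (fun _ => by positivity) hd htr'
  exact (hasSum_prod_swap this).prod_fiberwise fun l => QBenchmark.hasSum_normSq (v l)

theorem _root_.ContinuousLinearMap.IsPositive.exists_eq_star_mul_self {E : Type*}
    [NormedAddCommGroup E] [InnerProductSpace ℂ E] [CompleteSpace E] {T : E →L[ℂ] E}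
    (h : T.IsPositive) : ∃ S : E →L[ℂ] E, T = star S * S :=
  CStarAlgebra.nonneg_iff_eq_star_mul_self.1 ((ContinuousLinearMap.nonneg_iff_isPositive T).2 h)

/-- The ensemble comes from a factorisation `T = S† S`: its vectors are `S† |l⟩`. -/
theorem IsDensity.exists_ensemble {T : Op X} (hT : IsDensity T) :
    ∃ v : X → Hil X, IsEnsemble v (mat T) ∧ HasSum (fun l => ‖v l‖ ^ 2) 1 := by
  obtain ⟨S, hS⟩ := hT.1.exists_eq_star_mul_self
  have hens : IsEnsemble (fun l => star S (ket l)) (mat T) := by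
    intro q p
    have := hasSum_mat_mul (star S) (S (ket p)) q
    have h2 : (fun l => (star S (ket l)) q * star ((star S (ket l)) p)) =
        fun l => mat (star S) q l * (S (ket p)) l := by
      funext l
      rw [adjoint_ket_apply S l p, star_star, mat_eq_apply, mat_eq_apply]
    rw [h2, hS]
    exact this
  exact ⟨_, hens, hens.hasSum_normSq (by simpa using hT.2)⟩

end

/-! ### Product vectors and partial inner products -/

section

variable {n ι κ : Type*}

theorem memℓp_two_iff {X : Type*} {f : X → ℂ} :
    Memℓp (E := fun _ : X => ℂ) f 2 ↔ Summable fun x => ‖f x‖ ^ 2 := by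
  rw [memℓp_gen_iff (by simp)]
  simp

theorem memℓp_tens (u : Hil ι) (z : Hil κ) :
    Memℓp (E := fun _ : ι × κ => ℂ) (fun p => u p.1 * z p.2) 2 := by
  rw [memℓp_two_iff]
  have := (hasSum_normSq u).summable.mul_of_nonneg (hasSum_normSq z).summable
    (fun _ => by positivity) (fun _ => by positivity)
  simpa only [norm_mul, mul_pow] using this

/-- The product vector `u ⊗ z`, with values in `ℓ²(ι × κ)`. -/
noncomputable def tensVec (u : Hil ι) (z : Hil κ) : Hil (ι × κ) :=
  ⟨fun p => u p.1 * z p.2, memℓp_tens u z⟩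

theorem norm_tensVec (u : Hil ι) (z : Hil κ) : ‖tensVec u z‖ = ‖u‖ * ‖z‖ := by
  have h1 := hasSum_normSq (tensVec u z)
  have h2 : HasSum (fun p : ι × κ => ‖tensVec u z p‖ ^ 2) (‖u‖ ^ 2 * ‖z‖ ^ 2) := by
    refine hasSum_prod_of_nonneg (fun _ => by positivity)
      (fun i => ?_) ((hasSum_normSq u).mul_right (‖z‖ ^ 2))
    have h3 := (hasSum_normSq z).mul_left (‖u i‖ ^ 2)
    have h4 : (fun s => ‖tensVec u z (i, s)‖ ^ 2) = fun s => ‖u i‖ ^ 2 * ‖z s‖ ^ 2 := by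
      funext s
      rw [← mul_pow, ← norm_mul]
      rfl
    rwa [h4]
  have h5 := h1.unique h2
  rw [← mul_pow] at h5
  exact (pow_left_inj₀ (norm_nonneg _) (by positivity) two_ne_zero).1 h5

/-- The product of vectors as a continuous bilinear map. -/
noncomputable def tens : Hil ι →L[ℂ] Hil κ →L[ℂ] Hil (ι × κ) :=
  LinearMap.mkContinuous₂
    (LinearMap.mk₂ ℂ tensVec
      (fun u u' z => by ext p; exact add_mul (u p.1) (u' p.1) (z p.2))
      (fun c u z => by ext p; exact mul_assoc c (u p.1) (z p.2))
      (fun u z z' => by ext p; exact mul_add (u p.1) (z p.2) (z' p.2))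
      (fun c u z => by ext p; exact mul_left_comm (u p.1) c (z p.2)))
    1 (fun u z => by rw [one_mul]; exact (norm_tensVec u z).le)

theorem tens_apply (u : Hil ι) (z : Hil κ) (p : ι × κ) :
    (tens u z : ι × κ → ℂ) p = u p.1 * z p.2 := rfl

theorem norm_tens (u : Hil ι) (z : Hil κ) : ‖tens u z‖ = ‖u‖ * ‖z‖ := norm_tensVec u z

theorem tens_ket (i : ι) (r : κ) : tens (ket i) (ket r) = ket (i, r) := by
  ext p
  rw [tens_apply, ket_apply, ket_apply, ket_apply]
  by_cases h1 : p.1 = i <;> by_cases h2 : p.2 = r <;> simp [h1, h2, Prod.ext_iff]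

theorem norm_tens_flip_le (z : Hil κ) : ‖(tens.flip z : Hil ι →L[ℂ] Hil (ι × κ))‖ ≤ ‖z‖ :=
  ContinuousLinearMap.opNorm_le_bound _ (norm_nonneg _) fun u => by
    rw [ContinuousLinearMap.flip_apply, norm_tens, mul_comm]

theorem summable_slice (v : Hil (n × κ)) (a : n) : Summable fun s => ‖v (a, s)‖ ^ 2 :=
  (hasSum_normSq v).summable.comp_injective (i := fun s : κ => (a, s))
    fun _ _ h => (Prod.ext_iff.1 h).2

/-- The partial inner product `(⟨a| ⊗ I) v` with a basis vector of the first factor. -/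
noncomputable def slice (v : Hil (n × κ)) (a : n) : Hil κ :=
  ⟨fun s => v (a, s), memℓp_two_iff.2 (summable_slice v a)⟩

theorem slice_apply (v : Hil (n × κ)) (a : n) (s : κ) : (slice v a : κ → ℂ) s = v (a, s) := rfl

theorem norm_slice_le (v : Hil (n × κ)) (a : n) : ‖slice v a‖ ≤ ‖v‖ := by
  refine (pow_le_pow_iff_left₀ (norm_nonneg _) (norm_nonneg _) two_ne_zero).1 ?_
  rw [← (hasSum_normSq (slice v a)).tsum_eq, ← (hasSum_normSq v).tsum_eq]
  exact (hasSum_normSq (slice v a)).summable.tsum_le_tsum_of_inj (fun s : κ => (a, s))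
    (fun _ _ h => (Prod.ext_iff.1 h).2) (fun _ _ => by positivity) (fun _ => le_rfl)
    (hasSum_normSq v).summable

variable [Fintype n]

/-- The partial inner product `(⟨w| ⊗ I) v`. -/
noncomputable def contract (w : EuclideanSpace ℂ n) (v : Hil (n × κ)) : Hil κ :=
  ∑ a, star (w a) • slice v a

theorem contract_apply (w : EuclideanSpace ℂ n) (v : Hil (n × κ)) (s : κ) :
    (contract w v : κ → ℂ) s = ∑ a, star (w a) * v (a, s) := by
  rw [← inner_ket, contract, inner_sum]
  refine Finset.sum_congr rfl fun a _ => ?_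
  rw [inner_smul_right, inner_ket, slice_apply]

theorem norm_contract_le (w : EuclideanSpace ℂ n) (v : Hil (n × κ)) :
    ‖contract w v‖ ≤ Fintype.card n * (‖w‖ * ‖v‖) := by
  refine (norm_sum_le _ _).trans ?_
  rw [← nsmul_eq_mul, ← Finset.card_univ]
  refine Finset.sum_le_card_nsmul _ _ _ fun a _ => ?_
  rw [norm_smul, norm_star]
  gcongr
  · exact PiLp.norm_apply_le w a
  · exact norm_slice_le v a

end

/-! ### The blocks of the performance operator -/

section

variable {n ι κ : Type*}

theorem hasSum_inner_apply {β E F : Type*} [NormedAddCommGroup E] [NormedSpace ℂ E]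
    [NormedAddCommGroup F] [InnerProductSpace ℂ F] {f : β → E →L[ℂ] F} {T : E →L[ℂ] F}
    (h : HasSum f T) (u : F) (x : E) : HasSum (fun b => inner ℂ u (f b x)) (inner ℂ u (T x)) :=
  ((innerSL ℂ u).comp (ContinuousLinearMap.apply ℂ F x)).hasSum h

theorem inner_adjoint_comp {E E' F F' : Type*} [NormedAddCommGroup E] [InnerProductSpace ℂ E]
    [CompleteSpace E] [NormedAddCommGroup F] [InnerProductSpace ℂ F] [CompleteSpace F]
    [NormedAddCommGroup E'] [NormedSpace ℂ E'] [NormedAddCommGroup F'] [NormedSpace ℂ F']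
    (A : E →L[ℂ] F) (O : F' →L[ℂ] F) (B : E' →L[ℂ] F') (x : E) (y : E') :
    inner ℂ x ((ContinuousLinearMap.adjoint A ∘L O ∘L B) y) = inner ℂ (A x) (O (B y)) :=
  ContinuousLinearMap.adjoint_inner_right A x (O (B y))

namespace Test

/-- A decomposition `σ = ∑ₗ |vₗ⟩⟨vₗ|` of the input state of a test into (unnormalised) pure
states. -/
noncomputable def ensemble (T : Test n ι κ) : n × κ → Hil (n × κ) :=
  T.σ_density.exists_ensemble.choose

theorem isEnsemble_ensemble (T : Test n ι κ) : IsEnsemble T.ensemble (mat T.σ) :=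
  T.σ_density.exists_ensemble.choose_spec.1

theorem hasSum_normSq_ensemble (T : Test n ι κ) : HasSum (fun l => ‖T.ensemble l‖ ^ 2) 1 :=
  T.σ_density.exists_ensemble.choose_spec.2

theorem summable_normSq_slice (T : Test n ι κ) (a : n) :
    Summable fun l => ‖slice (T.ensemble l) a‖ ^ 2 :=
  Summable.of_nonneg_of_le (fun _ => by positivity)
    (fun l => pow_le_pow_left₀ (norm_nonneg _) (norm_slice_le _ a) 2)
    T.hasSum_normSq_ensemble.summable

/-- The contribution of the `l`-th pure state of the input ensemble to `Test.block`. -/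
noncomputable def blockTerm (T : Test n ι κ) (a b : n) (l : n × κ) : Op ι :=
  ContinuousLinearMap.adjoint (tens.flip (slice (T.ensemble l) b)) ∘L T.O ∘L
    tens.flip (slice (T.ensemble l) a)

/-- The block `⟨a| Ω |b⟩` of the performance operator, a bounded operator on the output system:
`Tr_R[O (I ⊗ ⟨a|σ|b⟩)]`. -/
noncomputable def block (T : Test n ι κ) (a b : n) : Op ι := ∑' l, T.blockTerm a b l

theorem summable_blockTerm (T : Test n ι κ) (a b : n) : Summable (T.blockTerm a b) := by
  have hs : Summable fun l => ‖T.O‖ * ‖T.ensemble l‖ ^ 2 :=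
    T.hasSum_normSq_ensemble.summable.mul_left _
  refine Summable.of_norm_bounded hs fun l => ?_
  have hle : ∀ c : n, ‖(tens.flip (slice (T.ensemble l) c) : Hil ι →L[ℂ] Hil (ι × κ))‖ ≤
      ‖T.ensemble l‖ := fun c => (norm_tens_flip_le _).trans (norm_slice_le _ c)
  calc ‖T.blockTerm a b l‖ ≤ ‖T.ensemble l‖ * (‖T.O‖ * ‖T.ensemble l‖) := by
        refine (ContinuousLinearMap.opNorm_comp_le _ _).trans ?_
        refine mul_le_mul ?_ ((ContinuousLinearMap.opNorm_comp_le _ _).trans ?_)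
          (norm_nonneg _) (norm_nonneg _)
        · rw [LinearIsometryEquiv.norm_map]
          exact hle b
        · exact mul_le_mul_of_nonneg_left (hle a) (norm_nonneg _)
    _ = _ := by ring

theorem hasSum_inner_block (T : Test n ι κ) (a b : n) (u u' : Hil ι) :
    HasSum (fun l => inner ℂ (tens u (slice (T.ensemble l) b))
      (T.O (tens u' (slice (T.ensemble l) a)))) (inner ℂ u (T.block a b u')) := by
  have h := hasSum_inner_apply (T.summable_blockTerm a b).hasSum u u'
  have h2 : ∀ l, inner ℂ u (T.blockTerm a b l u') = inner ℂ (tens u (slice (T.ensemble l) b))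
      (T.O (tens u' (slice (T.ensemble l) a))) := fun l => inner_adjoint_comp _ _ _ _ _
  simp only [h2] at h
  exact h

theorem performanceOperator_eq_mat_block (T : Test n ι κ) (p q : ι × n) :
    T.performanceOperator p q = mat (T.block p.2 q.2) p.1 q.1 := by
  -- the block `⟨i| O |j⟩` of the observable, an operator on the reference system
  set O' : Op κ := ContinuousLinearMap.adjoint (tens (ket p.1)) ∘L T.O ∘L tens (ket q.1) with hO'
  have hinner : ∀ x y : Hil κ,
      inner ℂ x (O' y) = inner ℂ (tens (ket p.1) x) (T.O (tens (ket q.1) y)) := fun x y =>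
    inner_adjoint_comp _ _ _ _ _
  have hmat : ∀ r s, mat T.O (p.1, r) (q.1, s) = mat O' r s := fun r s => by
    rw [mat_eq_inner, mat_eq_inner, hinner, tens_ket, tens_ket]
  have h := tsum_mat_mul_eq_tsum_inner O' (x := fun l => slice (T.ensemble l) q.2)
    (y := fun l => slice (T.ensemble l) p.2) (N := fun s r => mat T.σ (p.2, s) (q.2, r))
    (T.summable_normSq_slice q.2) (T.summable_normSq_slice p.2)
    (fun s r => T.isEnsemble_ensemble (p.2, s) (q.2, r))
  simp only [performanceOperator, hmat]
  rw [h, mat_eq_inner, ← (T.hasSum_inner_block p.2 q.2 (ket p.1) (ket q.1)).tsum_eq]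
  exact tsum_congr fun l => hinner _ _

variable [Fintype n]

/-- The quadratic form `⟨u ⊗ w| Ω |u ⊗ w⟩` of the performance operator on product vectors. -/
noncomputable def expect (T : Test n ι κ) (u : Hil ι) (w : EuclideanSpace ℂ n) : ℂ :=
  ∑ a, ∑ b, star (w a) * w b * inner ℂ u (T.block a b u)

theorem productExpectation_eq_re_expect (T : Test n ι κ) (u : Hil ι) (w : EuclideanSpace ℂ n) :
    productExpectation T.performanceOperator u w = (T.expect u w).re := by
  rw [productExpectation]
  congr 1
  have h1 : ∀ p : ι × n, HasSum (fun q : ι × n =>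
      star (u p.1 * w p.2) * T.performanceOperator p q * (u q.1 * w q.2))
      (∑ b, star (u p.1 * w p.2) * w b * (T.block p.2 b u) p.1) := by
    intro p
    refine hasSum_prod_fintype fun b => ?_
    have := (hasSum_mat_mul (T.block p.2 b) u p.1).mul_left (star (u p.1 * w p.2) * w b)
    have h2 : (fun j => star (u p.1 * w p.2) * T.performanceOperator p (j, b) * (u j * w b)) =
        fun j => star (u p.1 * w p.2) * w b * (mat (T.block p.2 b) p.1 j * u j) := by
      funext j
      rw [performanceOperator_eq_mat_block]
      ring
    rwa [← h2] at this
  rw [tsum_congr fun p => (h1 p).tsum_eq]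
  refine HasSum.tsum_eq (hasSum_prod_fintype fun a => hasSum_sum fun b _ => ?_)
  have := (hasSum_mul_star u (T.block a b u)).mul_left (star (w a) * w b)
  have h2 : (fun i => star (u i * w a) * w b * (T.block a b u) i) =
      fun i => star (w a) * w b * ((T.block a b u) i * star (u i)) := by
    funext i
    rw [star_mul]
    ring
  rwa [← h2] at this

theorem hasSum_expect (T : Test n ι κ) (u : Hil ι) (w : EuclideanSpace ℂ n) :
    HasSum (fun l => inner ℂ (tens u (contract w (T.ensemble l)))
      (T.O (tens u (contract w (T.ensemble l))))) (T.expect u w) := by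
  have h : HasSum (fun l => ∑ a, ∑ b, star (w a) * w b *
      inner ℂ (tens u (slice (T.ensemble l) b)) (T.O (tens u (slice (T.ensemble l) a))))
      (T.expect u w) :=
    hasSum_sum fun a _ => hasSum_sum fun b _ => (T.hasSum_inner_block a b u u).mul_left _
  have h2 : (fun l => inner ℂ (tens u (contract w (T.ensemble l)))
      (T.O (tens u (contract w (T.ensemble l))))) = fun l => ∑ a, ∑ b, star (w a) * w b *
      inner ℂ (tens u (slice (T.ensemble l) b)) (T.O (tens u (slice (T.ensemble l) a))) := by
    funext l
    simp only [contract, map_sum, map_smul, inner_sum, sum_inner, inner_smul_left,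
      inner_smul_right, Finset.mul_sum]
    refine Finset.sum_congr rfl fun a _ => Finset.sum_congr rfl fun b _ => ?_
    rw [Complex.star_def, Complex.conj_conj, mul_assoc]
  rwa [h2]

/-- A constant bounding the quadratic form `Test.expect`. -/
noncomputable def bound (T : Test n ι κ) : ℝ := ∑ a, ∑ b, ‖T.block a b‖

theorem norm_expect_le (T : Test n ι κ) (u : Hil ι) (w : EuclideanSpace ℂ n) :
    ‖T.expect u w‖ ≤ T.bound * (‖u‖ ^ 2 * ‖w‖ ^ 2) := by
  rw [bound, Finset.sum_mul]
  refine (norm_sum_le _ _).trans (Finset.sum_le_sum fun a _ => ?_)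
  rw [Finset.sum_mul]
  refine (norm_sum_le _ _).trans (Finset.sum_le_sum fun b _ => ?_)
  rw [norm_mul, norm_mul, norm_star]
  calc ‖w a‖ * ‖w b‖ * ‖inner ℂ u (T.block a b u)‖
      ≤ ‖w‖ * ‖w‖ * (‖u‖ * (‖T.block a b‖ * ‖u‖)) := by
        gcongr
        · exact PiLp.norm_apply_le w a
        · exact PiLp.norm_apply_le w b
        · refine (norm_inner_le_norm _ _).trans ?_
          gcongr
          exact (T.block a b).le_opNorm u
    _ = _ := by ring

theorem expect_smul (T : Test n ι κ) (c d : ℂ) (u : Hil ι) (w : EuclideanSpace ℂ n) :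
    T.expect (c • u) (d • w) = (‖c‖ ^ 2 * ‖d‖ ^ 2 : ℝ) * T.expect u w := by
  simp only [expect, Finset.mul_sum, map_smul, inner_smul_left, inner_smul_right]
  refine Finset.sum_congr rfl fun a _ => Finset.sum_congr rfl fun b _ => ?_
  have hc := Complex.mul_conj' c
  have hd := Complex.mul_conj' d
  simp only [PiLp.smul_apply, smul_eq_mul, star_mul, Complex.star_def]
  push_cast
  rw [← hc, ← hd]
  ring

theorem bddAbove_productNumericalRange (T : Test n ι κ) :
    BddAbove {x | ∃ (α' : Hil ι) (α : EuclideanSpace ℂ n),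
      ‖α'‖ = 1 ∧ ‖α‖ = 1 ∧ x = productExpectation T.performanceOperator α' α} := by
  refine ⟨T.bound, ?_⟩
  rintro x ⟨u, w, hu, hw, rfl⟩
  rw [productExpectation_eq_re_expect]
  have := T.norm_expect_le u w
  rw [hu, hw] at this
  exact (Complex.re_le_norm _).trans (this.trans_eq (by ring))

/-- The bound by the product numerical range, for vectors of any norm. -/
theorem re_expect_le (T : Test n ι κ) (u : Hil ι) (w : EuclideanSpace ℂ n) :
    (T.expect u w).re ≤ productNumericalRange T.performanceOperator * (‖u‖ ^ 2 * ‖w‖ ^ 2) := by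
  rcases eq_or_ne u 0 with rfl | hu
  · simp [expect]
  rcases eq_or_ne w 0 with rfl | hw
  · simp [expect]
  have hu' : ‖u‖ ≠ 0 := norm_ne_zero_iff.2 hu
  have hw' : ‖w‖ ≠ 0 := norm_ne_zero_iff.2 hw
  have h1 : (T.expect ((‖u‖⁻¹ : ℂ) • u) ((‖w‖⁻¹ : ℂ) • w)).re ≤
      productNumericalRange T.performanceOperator := by
    refine le_csSup T.bddAbove_productNumericalRange ⟨_, _, ?_, ?_,
      (T.productExpectation_eq_re_expect _ _).symm⟩
    · rw [norm_smul, norm_inv, Complex.norm_real, norm_norm, inv_mul_cancel₀ hu']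
    · rw [norm_smul, norm_inv, Complex.norm_real, norm_norm, inv_mul_cancel₀ hw']
  rw [expect_smul, Complex.re_ofReal_mul, norm_inv, norm_inv, Complex.norm_real,
    Complex.norm_real, norm_norm, norm_norm, inv_pow, inv_pow, ← mul_inv, inv_mul_le_iff₀
    (by positivity)] at h1
  linarith

end Test

end

/-! ### Scores of measure-and-prepare devices -/

section

variable {n ι κ : Type*} [Fintype n]

/-- The quadratic form `⟨w| X |w⟩` of a matrix. -/
noncomputable def quadForm (X : Matrix n n ℂ) (w : EuclideanSpace ℂ n) : ℂ :=
  ∑ a, ∑ b, star (w a) * X a b * w b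

theorem norm_quadForm_le (X : Matrix n n ℂ) (w : EuclideanSpace ℂ n) :
    ‖quadForm X w‖ ≤ (∑ a, ∑ b, ‖X a b‖) * ‖w‖ ^ 2 := by
  rw [Finset.sum_mul]
  refine (norm_sum_le _ _).trans (Finset.sum_le_sum fun a _ => ?_)
  rw [Finset.sum_mul]
  refine (norm_sum_le _ _).trans (Finset.sum_le_sum fun b _ => ?_)
  rw [norm_mul, norm_mul, norm_star]
  calc ‖w a‖ * ‖X a b‖ * ‖w b‖ ≤ ‖w‖ * ‖X a b‖ * ‖w‖ := by
        gcongr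
        · exact PiLp.norm_apply_le w a
        · exact PiLp.norm_apply_le w b
    _ = _ := by ring

/-- The score of a device `C(X) = ∑ⱼ ⟨wⱼ| X |wⱼ⟩ |uⱼ⟩⟨uⱼ|` depends on the test only through its
performance operator. The output `(C ⊗ id)(σ)` is the sum of the rank-one operators of the vectors
`uⱼ ⊗ (⟨wⱼ| ⊗ I) vₗ`, where `σ = ∑ₗ |vₗ⟩⟨vₗ|`. -/
theorem Test.hasSum_score (T : Test n ι κ) {J : Type*} {u : J → Hil ι}
    {w : J → EuclideanSpace ℂ n} {C : Matrix n n ℂ →ₗ[ℂ] Op ι}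
    (hs : Summable fun j => ‖u j‖ ^ 2 * ‖w j‖ ^ 2)
    (hC : ∀ X i i', HasSum (fun j => quadForm X (w j) * (u j i * star (u j i'))) (mat (C X) i i')) :
    HasSum (fun j => (T.expect (u j) (w j)).re) (T.score C) := by
  set y : J × (n × κ) → Hil (ι × κ) := fun t => tens (u t.1) (contract (w t.1) (T.ensemble t.2))
    with hy
  have hysq : Summable fun t => ‖y t‖ ^ 2 := by
    have h1 := (hs.mul_of_nonneg T.hasSum_normSq_ensemble.summable (fun _ => by positivity)
      (fun _ => by positivity)).mul_left ((Fintype.card n : ℝ) ^ 2)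
    refine Summable.of_nonneg_of_le (fun _ => by positivity) (fun t => ?_) h1
    rw [hy, norm_tens]
    calc (‖u t.1‖ * ‖contract (w t.1) (T.ensemble t.2)‖) ^ 2
        ≤ (‖u t.1‖ * (Fintype.card n * (‖w t.1‖ * ‖T.ensemble t.2‖))) ^ 2 := by
          gcongr
          exact norm_contract_le _ _
      _ = _ := by ring
  have hquad : ∀ (j : J) (s r : κ), HasSum (fun l => (contract (w j) (T.ensemble l)) s *
      star ((contract (w j) (T.ensemble l)) r))
      (quadForm (fun a b => mat T.σ (a, s) (b, r)) (w j)) := by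
    intro j s r
    have h1 : HasSum (fun l => ∑ a, ∑ b, star (w j a) *
        (T.ensemble l (a, s) * star (T.ensemble l (b, r))) * w j b)
        (quadForm (fun a b => mat T.σ (a, s) (b, r)) (w j)) :=
      hasSum_sum fun a _ => hasSum_sum fun b _ =>
        ((T.isEnsemble_ensemble (a, s) (b, r)).mul_left _).mul_right _
    have h2 : (fun l => (contract (w j) (T.ensemble l)) s *
        star ((contract (w j) (T.ensemble l)) r)) = fun l => ∑ a, ∑ b, star (w j a) *
        (T.ensemble l (a, s) * star (T.ensemble l (b, r))) * w j b := by
      funext l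
      rw [contract_apply, contract_apply, star_sum, Finset.sum_mul_sum]
      refine Finset.sum_congr rfl fun a _ => Finset.sum_congr rfl fun b _ => ?_
      rw [star_mul, star_star]
      ring
    rwa [h2]
  have hN : ∀ q p, HasSum (fun t => y t q * star (y t p)) (applyLeft C T.σ q p) := by
    intro q p
    refine hasSum_prod_of_fiberwise (g := fun j =>
      quadForm (fun a b => mat T.σ (a, q.2) (b, p.2)) (w j) * (u j q.1 * star (u j p.1)))
      ?_ (fun j => ?_) (hC _ q.1 p.1)
    · refine summable_mul_of_sq (f := fun t => y t q) (g := fun t => star (y t p))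
        (summable_sq_apply hysq q) ?_
      simpa only [norm_star] using summable_sq_apply hysq p
    · have h1 := (hquad j q.2 p.2).mul_right (u j q.1 * star (u j p.1))
      have h2 : (fun l => y (j, l) q * star (y (j, l) p)) =
          fun l => (contract (w j) (T.ensemble l)) q.2 *
            star ((contract (w j) (T.ensemble l)) p.2) * (u j q.1 * star (u j p.1)) := by
        funext l
        rw [hy, tens_apply, tens_apply, star_mul]
        ring
      rwa [h2]
  have htr := tsum_mat_mul_eq_tsum_inner T.O hysq hysq hN
  have hsum : Summable fun t => inner ℂ (y t) (T.O (y t)) := by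
    refine Summable.of_norm_bounded (hysq.mul_left ‖T.O‖) fun t => ?_
    refine (norm_inner_le_norm _ _).trans ?_
    calc ‖y t‖ * ‖T.O (y t)‖ ≤ ‖y t‖ * (‖T.O‖ * ‖y t‖) := by
          gcongr
          exact T.O.le_opNorm _
      _ = _ := by ring
  have h3 := hsum.hasSum.prod_fiberwise fun j => T.hasSum_expect (u j) (w j)
  rw [← htr] at h3
  exact Complex.hasSum_re h3

open scoped MatrixOrder Matrix.Norms.L2Operator in
/-- A positive matrix is a finite sum of rank-one matrices `|w⟩⟨w|`. -/
theorem _root_.Matrix.PosSemidef.exists_eq_sum {P : Matrix n n ℂ} (hP : P.PosSemidef) :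
    ∃ w : n → EuclideanSpace ℂ n, ∀ a b, P a b = ∑ m, w m a * star (w m b) := by
  classical
  obtain ⟨B, rfl⟩ := CStarAlgebra.nonneg_iff_eq_star_mul_self.1 hP.nonneg
  refine ⟨fun m => WithLp.toLp 2 fun a => star (B m a), fun a b => ?_⟩
  simp [Matrix.mul_apply, Matrix.star_eq_conjTranspose]

theorem trace_mul_eq_sum_quadForm {K : Type*} [Fintype K] {P : Matrix n n ℂ}
    {w : K → EuclideanSpace ℂ n} (h : ∀ a b, P a b = ∑ m, w m a * star (w m b))
    (X : Matrix n n ℂ) : (P * X).trace = ∑ m, quadForm X (w m) := by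
  calc (P * X).trace = ∑ b, ∑ a, ∑ m, star (w m a) * X a b * w m b := by
        simp only [Matrix.trace, Matrix.diag, Matrix.mul_apply, h, Finset.sum_mul]
        refine Finset.sum_congr rfl fun b _ => Finset.sum_congr rfl fun a _ =>
          Finset.sum_congr rfl fun m _ => ?_
        ring
    _ = ∑ b, ∑ m, ∑ a, star (w m a) * X a b * w m b :=
        Finset.sum_congr rfl fun b _ => Finset.sum_comm
    _ = ∑ m, ∑ b, ∑ a, star (w m a) * X a b * w m b := Finset.sum_comm
    _ = ∑ m, quadForm X (w m) := Finset.sum_congr rfl fun m _ => Finset.sum_comm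

theorem re_trace_eq_sum_normSq {K : Type*} [Fintype K] {P : Matrix n n ℂ}
    {w : K → EuclideanSpace ℂ n} (h : ∀ a b, P a b = ∑ m, w m a * star (w m b)) :
    P.trace.re = ∑ m, ‖w m‖ ^ 2 := by
  simp only [Matrix.trace, Matrix.diag, h, EuclideanSpace.norm_sq_eq, Complex.re_sum]
  rw [Finset.sum_comm]
  refine Finset.sum_congr rfl fun m _ => Finset.sum_congr rfl fun a _ => ?_
  rw [Complex.star_def, Complex.mul_conj, Complex.ofReal_re, Complex.normSq_eq_norm_sq]

theorem hasSum_re_trace {P : ℕ → Matrix n n ℂ} {E : Matrix n n ℂ} (h : HasSum P E) :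
    HasSum (fun k => (P k).trace.re) E.trace.re := by
  have h1 : HasSum (fun k => (P k).trace) E.trace :=
    h.map (Matrix.traceAddMonoidHom n ℂ) (by
      simpa [Matrix.traceAddMonoidHom] using
        (continuous_id.matrix_trace : Continuous fun A : Matrix n n ℂ => A.trace))
  exact Complex.hasSum_re h1

/-- Every measure-and-prepare device can be refined to one that measures rank-one operators and
prepares pure states. -/
theorem MeasuresAndPrepares.exists_refinement {E : Matrix n n ℂ} {C : Matrix n n ℂ →ₗ[ℂ] Op ι}
    (h : MeasuresAndPrepares E C) :
    ∃ (u : ℕ × (ι × n) → Hil ι) (w : ℕ × (ι × n) → EuclideanSpace ℂ n),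
      HasSum (fun j => ‖u j‖ ^ 2 * ‖w j‖ ^ 2) E.trace.re ∧
      ∀ X i i', HasSum (fun j => quadForm X (w j) * (u j i * star (u j i'))) (mat (C X) i i') := by
  obtain ⟨P, ρ, hP, hPE, hρ, hC⟩ := h
  choose w hw using fun k => (hP k).exists_eq_sum
  choose u hu hu1 using fun k => (hρ k).exists_ensemble
  have hnorm : HasSum (fun j : ℕ × (ι × n) => ‖u j.1 j.2.1‖ ^ 2 * ‖w j.1 j.2.2‖ ^ 2)
      E.trace.re := by
    refine hasSum_prod_of_nonneg (fun _ => by positivity) (fun k => ?_) (hasSum_re_trace hPE)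
    rw [re_trace_eq_sum_normSq (hw k)]
    refine hasSum_prod_fintype fun m => ?_
    simpa using (hu1 k).mul_right (‖w k m‖ ^ 2)
  refine ⟨fun j => u j.1 j.2.1, fun j => w j.1 j.2.2, hnorm, fun X i i' => ?_⟩
  refine hasSum_prod_of_fiberwise (g := fun k => mat ((P k * X).trace • ρ k) i i') ?_ (fun k => ?_)
    (hasSum_mat (hC X) i i')
  · refine Summable.of_norm_bounded (hnorm.summable.mul_left (∑ a, ∑ b, ‖X a b‖)) fun j => ?_
    rw [norm_mul, norm_mul, norm_star]
    have hle : ∀ i, ‖u j.1 j.2.1 i‖ ≤ ‖u j.1 j.2.1‖ := fun i => lp.norm_apply_le_norm (by simp) _ i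
    calc _ ≤ ((∑ a, ∑ b, ‖X a b‖) * ‖w j.1 j.2.2‖ ^ 2) * (‖u j.1 j.2.1‖ * ‖u j.1 j.2.1‖) := by
          gcongr
          · exact norm_quadForm_le _ _
          · exact hle i
          · exact hle i'
      _ = _ := by ring
  · rw [mat_smul, trace_mul_eq_sum_quadForm (hw k), Finset.sum_mul]
    exact hasSum_prod_fintype
      (f := fun z : ι × n => quadForm X (w k z.2) * (u k z.1 i * star (u k z.1 i')))
      fun m => (hu k i i').mul_left (quadForm X (w k m))

/-- The upper bound `Λ Tr E` on the scores of the devices that measure `E`. -/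
theorem MeasuresAndPrepares.score_le {E : Matrix n n ℂ} {C : Matrix n n ℂ →ₗ[ℂ] Op ι}
    (h : MeasuresAndPrepares E C) (T : Test n ι κ) :
    T.score C ≤ E.trace.re * productNumericalRange T.performanceOperator := by
  obtain ⟨u, w, hn, hC⟩ := h.exists_refinement
  rw [mul_comm]
  exact hasSum_le (fun j => T.re_expect_le (u j) (w j)) (T.hasSum_score hn.summable hC)
    (hn.mul_left _)

/-- The output state `C(I)` has trace `Tr E`. -/
theorem MeasuresAndPrepares.tsum_mat_one [DecidableEq n] {E : Matrix n n ℂ}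
    {C : Matrix n n ℂ →ₗ[ℂ] Op ι} (h : MeasuresAndPrepares E C) :
    (∑' i, mat (C 1) i i).re = E.trace.re := by
  obtain ⟨u, w, hn, hC⟩ := h.exists_refinement
  have hq : ∀ w : EuclideanSpace ℂ n, quadForm 1 w = ((‖w‖ ^ 2 : ℝ) : ℂ) := by
    intro w
    rw [EuclideanSpace.norm_sq_eq, quadForm, Complex.ofReal_sum]
    refine Finset.sum_congr rfl fun a _ => ?_
    simp [Matrix.one_apply, Complex.conj_mul']
  have hd : ∀ i, HasSum (fun j => ((‖u j i‖ ^ 2 * ‖w j‖ ^ 2 : ℝ) : ℂ)) (mat (C 1) i i) := by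
    intro i
    have h2 : (fun j => quadForm 1 (w j) * (u j i * star (u j i))) =
        fun j => ((‖u j i‖ ^ 2 * ‖w j‖ ^ 2 : ℝ) : ℂ) := by
      funext j
      rw [hq, Complex.star_def, Complex.mul_conj', ← Complex.ofReal_pow, ← Complex.ofReal_mul,
        mul_comm]
    rw [← h2]
    exact hC 1 i i
  have hjoint := hasSum_prod_of_nonneg
    (f := fun z : (ℕ × (ι × n)) × ι => ‖u z.1 z.2‖ ^ 2 * ‖w z.1‖ ^ 2) (fun _ => by positivity)
    (fun j => (hasSum_normSq (u j)).mul_right (‖w j‖ ^ 2)) hn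
  rw [((Complex.hasSum_ofReal.2 (hasSum_prod_swap hjoint)).prod_fiberwise hd).tsum_eq,
    Complex.ofReal_re]

end

/-! ### Devices with finitely many outcomes -/

section

variable {n ι κ : Type*} [Fintype n]

theorem mat_rankOne (u : Hil ι) (i i' : ι) :
    mat (InnerProductSpace.rankOne ℂ u u) i i' = u i * star (u i') := by
  rw [mat_eq_inner, InnerProductSpace.rankOne_apply, inner_smul_right, inner_ket, mul_comm,
    ← inner_conj_symm, inner_ket]
  rfl

theorem isDensity_rankOne {u : Hil ι} (hu : ‖u‖ = 1) :
    IsDensity (InnerProductSpace.rankOne ℂ u u) := by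
  refine ⟨InnerProductSpace.isPositive_rankOne_self u, ?_⟩
  have h := hasSum_mul_star u u
  rw [inner_self_eq_norm_sq_to_K, hu] at h
  simpa [mat_rankOne] using h

/-- The device that measures finitely many rank-one operators `|wⱼ⟩⟨wⱼ|` and prepares the pure state
`uⱼ` on outcome `j`. -/
theorem exists_pure_device [Nonempty ι] {J : Type*} [Fintype J] {u : J → Hil ι}
    (hu : ∀ j, ‖u j‖ = 1) {w : J → EuclideanSpace ℂ n} {E : Matrix n n ℂ}
    (hE : ∀ a b, E a b = ∑ j, w j a * star (w j b)) :
    ∃ C : Matrix n n ℂ →ₗ[ℂ] Op ι, MeasuresAndPrepares E C ∧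
      ∀ {κ : Type*} (T : Test n ι κ), T.score C = ∑ j, (T.expect (u j) (w j)).re := by
  classical
  set P : J → Matrix n n ℂ := fun j => Matrix.vecMulVec (w j) (star (w j)) with hP
  set ρ : J → Op ι := fun j => InnerProductSpace.rankOne ℂ (u j) (u j) with hρ
  set C : Matrix n n ℂ →ₗ[ℂ] Op ι :=
    ∑ j, (Matrix.traceLinearMap n ℂ ℂ ∘ₗ LinearMap.mulLeft ℂ (P j)).smulRight (ρ j) with hC
  have hCX : ∀ X, C X = ∑ j, (P j * X).trace • ρ j := by
    intro X
    simp [hC]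
  -- the outcomes are numbered; the operator measured is zero at the numbers left over
  set e : J → ℕ := fun j => Fintype.equivFin J j with he
  have hinj : Function.Injective e := fun a b h =>
    (Fintype.equivFin J).injective (Fin.val_injective h)
  set i₀ : ι := Classical.arbitrary ι
  refine ⟨C, ⟨Function.extend e P 0, Function.extend e ρ
    fun _ => InnerProductSpace.rankOne ℂ (ket i₀) (ket i₀), fun k => ?_, ?_, fun k => ?_,
    fun X => ?_⟩, fun T => ?_⟩
  · by_cases hk : ∃ j, e j = k
    · obtain ⟨j, rfl⟩ := hk
      rw [hinj.extend_apply]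
      exact Matrix.posSemidef_vecMulVec_self_star _
    · rw [Function.extend_apply' _ _ _ hk]
      exact Matrix.PosSemidef.zero
  · rw [hasSum_extend_zero hinj]
    have hEP : E = ∑ j, P j := by
      ext a b
      rw [hE, Matrix.sum_apply]
      rfl
    rw [hEP]
    exact hasSum_fintype P
  · by_cases hk : ∃ j, e j = k
    · obtain ⟨j, rfl⟩ := hk
      rw [hinj.extend_apply]
      exact isDensity_rankOne (hu j)
    · rw [Function.extend_apply' _ _ _ hk]
      exact isDensity_rankOne (norm_ket i₀)
  · have h1 := (hasSum_extend_zero hinj).2 (hasSum_fintype fun j => (P j * X).trace • ρ j)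
    rw [← hCX] at h1
    convert h1 using 1
    funext k
    by_cases hk : ∃ j, e j = k
    · obtain ⟨j, rfl⟩ := hk
      simp only [hinj.extend_apply]
    · simp only [Function.extend_apply' _ _ _ hk, Pi.zero_apply, Matrix.zero_mul,
        Matrix.trace_zero, zero_smul]
  · refine (T.hasSum_score (Summable.of_finite) fun X i i' => ?_).unique (hasSum_fintype _)
    rw [hCX, mat_sum]
    convert hasSum_fintype _ using 1
    refine Finset.sum_congr rfl fun j _ => ?_
    rw [mat_smul, mat_rankOne, trace_mul_eq_sum_quadForm (K := Unit) (w := fun _ => w j)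
      fun a b => by simp [hP, Matrix.vecMulVec_apply]]
    simp

/-! ### Covariance -/

theorem hasSum_mat_mul_mat (S T : Op ι) (i k : ι) :
    HasSum (fun j => mat S i j * mat T j k) (mat (S * T) i k) :=
  hasSum_mat_mul S (T (ket k)) i

/-- Covariance `Ω (V ⊗ W) = (V ⊗ W) Ω` in terms of the blocks of `Ω`. -/
theorem Test.sum_smul_block_mul (T : Test n ι κ) {V : Op ι} {W : Matrix n n ℂ}
    (h : ∀ p q, ∑' r, T.performanceOperator p r * tensor V W r q =
      ∑' r, tensor V W p r * T.performanceOperator r q) (a b : n) :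
    ∑ c, W c b • (T.block a c * V) = ∑ c, W a c • (V * T.block c b) := by
  refine ext_mat fun i k => ?_
  have h1 : HasSum (fun r => T.performanceOperator (i, a) r * tensor V W r (k, b))
      (∑ c, W c b * mat (T.block a c * V) i k) := by
    refine hasSum_prod_fintype fun c => ?_
    have h2 := (hasSum_mat_mul_mat (T.block a c) V i k).mul_left (W c b)
    have h3 : (fun j => T.performanceOperator (i, a) (j, c) * tensor V W (j, c) (k, b)) =
        fun j => W c b * (mat (T.block a c) i j * mat V j k) := by
      funext j
      rw [T.performanceOperator_eq_mat_block, tensor]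
      ring
    rwa [← h3] at h2
  have h3 : HasSum (fun r => tensor V W (i, a) r * T.performanceOperator r (k, b))
      (∑ c, W a c * mat (V * T.block c b) i k) := by
    refine hasSum_prod_fintype fun c => ?_
    have h2 := (hasSum_mat_mul_mat V (T.block c b) i k).mul_left (W a c)
    have h4 : (fun j => tensor V W (i, a) (j, c) * T.performanceOperator (j, c) (k, b)) =
        fun j => W a c * (mat V i j * mat (T.block c b) j k) := by
      funext j
      rw [T.performanceOperator_eq_mat_block, tensor]
      ring
    rwa [← h4] at h2
  have h4 := h (i, a) (k, b)
  rw [h1.tsum_eq, h3.tsum_eq] at h4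
  simpa only [mat_sum, mat_smul] using h4

variable [DecidableEq n]

/-- Covariance makes the quadratic form constant along the orbit of a product vector. -/
theorem Test.expect_covariant (T : Test n ι κ) (V : unitary (Op ι)) (W : unitary (Matrix n n ℂ))
    (h : ∀ p q, ∑' r, T.performanceOperator p r * tensor (V : Op ι) (W : Matrix n n ℂ) r q =
      ∑' r, tensor (V : Op ι) (W : Matrix n n ℂ) p r * T.performanceOperator r q)
    (u : Hil ι) (w : EuclideanSpace ℂ n) :
    T.expect ((V : Op ι) u) (WithLp.toLp 2 ((W : Matrix n n ℂ).mulVec w)) = T.expect u w := by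
  obtain ⟨V, hV⟩ := V
  obtain ⟨W, hW⟩ := W
  simp only at h ⊢
  have hVV : ∀ x y : Hil ι, inner ℂ (V x) (V y) = inner ℂ x y := fun x y => by
    rw [← ContinuousLinearMap.adjoint_inner_right, ← ContinuousLinearMap.star_eq_adjoint,
      ← mul_apply_eq_comp, (Unitary.mem_iff.1 hV).1, one_apply_eq_self]
  have hWW : ∀ b c, ∑ a, star (W a b) * W a c = if b = c then 1 else 0 := fun b c => by
    have := congr_fun (congr_fun (Unitary.mem_iff.1 hW).1 b) c
    simpa [Matrix.mul_apply, Matrix.one_apply, Matrix.star_eq_conjTranspose] using this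
  have hcov : ∀ a c, ∑ b, W b c * inner ℂ (V u) (T.block a b (V u)) =
      ∑ b, W a b * inner ℂ u (T.block b c u) := by
    intro a c
    have := congrArg (fun S : Op ι => inner ℂ (V u) (S u)) (T.sum_smul_block_mul h a c)
    simpa only [sum_apply, inner_sum, smul_apply, inner_smul_right,
      mul_apply_eq_comp, hVV] using this
  have hstar : ∀ b, ∑ a, star (W.mulVec w a) * W a b = star (w b) := by
    intro b
    simp only [Matrix.mulVec, dotProduct, star_sum, star_mul, Finset.sum_mul]
    rw [Finset.sum_comm]
    simp only [mul_assoc, ← Finset.mul_sum, hWW]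
    simp
  calc T.expect (V u) (WithLp.toLp 2 (W.mulVec w))
      = ∑ a, ∑ b, ∑ c, star (W.mulVec w a) * w c *
          (W b c * inner ℂ (V u) (T.block a b (V u))) := by
        refine Finset.sum_congr rfl fun a _ => Finset.sum_congr rfl fun b _ => ?_
        change star (W.mulVec w a) * (∑ c, W b c * w c) * _ = _
        rw [Finset.mul_sum, Finset.sum_mul]
        refine Finset.sum_congr rfl fun c _ => ?_
        ring
    _ = ∑ a, ∑ c, ∑ b, star (W.mulVec w a) * w c *
          (W a b * inner ℂ u (T.block b c u)) := by
        refine Finset.sum_congr rfl fun a _ => ?_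
        rw [Finset.sum_comm]
        refine Finset.sum_congr rfl fun c _ => ?_
        rw [← Finset.mul_sum, ← Finset.mul_sum, hcov]
    _ = ∑ a, ∑ b, ∑ c, star (W.mulVec w a) * W a b * (w c * inner ℂ u (T.block b c u)) := by
        refine Finset.sum_congr rfl fun a _ => ?_
        rw [Finset.sum_comm]
        refine Finset.sum_congr rfl fun b _ => Finset.sum_congr rfl fun c _ => ?_
        ring
    _ = ∑ b, ∑ c, (∑ a, star (W.mulVec w a) * W a b) * (w c * inner ℂ u (T.block b c u)) := by
        rw [Finset.sum_comm]
        refine Finset.sum_congr rfl fun b _ => ?_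
        rw [Finset.sum_comm]
        simp only [Finset.sum_mul]
    _ = T.expect u w := by
        simp only [hstar, expect, mul_assoc]

end

/-! ### The orbit of a pure state under an irreducible representation -/

section

variable {n : Type*} [Fintype n]

/-- The squared Hilbert–Schmidt norm. -/
noncomputable def hsNormSq (X : Matrix n n ℂ) : ℝ := ∑ a, ∑ b, ‖X a b‖ ^ 2

theorem hsNormSq_eq_trace (X : Matrix n n ℂ) :
    ((hsNormSq X : ℝ) : ℂ) = (X.conjTranspose * X).trace := by
  rw [hsNormSq, Finset.sum_comm]
  simp [Matrix.trace, Matrix.mul_apply, Complex.conj_mul']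

theorem sq_norm_apply_le_hsNormSq (X : Matrix n n ℂ) (a b : n) : ‖X a b‖ ^ 2 ≤ hsNormSq X :=
  (Finset.single_le_sum (f := fun b => ‖X a b‖ ^ 2) (fun _ _ => by positivity)
    (Finset.mem_univ b)).trans
  (Finset.single_le_sum (f := fun a => ∑ b, ‖X a b‖ ^ 2) (fun _ _ => by positivity)
    (Finset.mem_univ a))

/-- The parallelogram law, in the form that makes a minimiser on a convex set unique. -/
theorem hsNormSq_midpoint (X Y : Matrix n n ℂ) :
    hsNormSq ((2⁻¹ : ℝ) • X + (2⁻¹ : ℝ) • Y) =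
      (hsNormSq X + hsNormSq Y) / 2 - hsNormSq (X - Y) / 4 := by
  simp only [hsNormSq, ← Finset.sum_add_distrib, Finset.sum_div, ← Finset.sum_sub_distrib]
  refine Finset.sum_congr rfl fun a _ => Finset.sum_congr rfl fun b _ => ?_
  simp only [Matrix.add_apply, Matrix.smul_apply, Matrix.sub_apply, ← Complex.normSq_eq_norm_sq,
    Complex.normSq_apply, Complex.add_re, Complex.add_im, Complex.smul_re, Complex.smul_im,
    Complex.sub_re, Complex.sub_im, smul_eq_mul]
  ring

variable [DecidableEq n]

theorem hsNormSq_unitary_conj {W : Matrix n n ℂ} (hW : star W * W = 1) (X : Matrix n n ℂ) :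
    hsNormSq (W * X * star W) = hsNormSq X := by
  have h : (((hsNormSq (W * X * star W) : ℝ)) : ℂ) = (hsNormSq X : ℝ) := by
    rw [hsNormSq_eq_trace, hsNormSq_eq_trace, Matrix.conjTranspose_mul, Matrix.conjTranspose_mul,
      ← Matrix.star_eq_conjTranspose, ← Matrix.star_eq_conjTranspose, star_star]
    calc (W * (star X * star W) * (W * X * star W)).trace
        = (W * (star X * (star W * W) * X * star W)).trace := by simp only [Matrix.mul_assoc]
      _ = (star X * X).trace := by
          rw [Matrix.trace_mul_comm, hW, Matrix.mul_one, Matrix.mul_assoc, Matrix.mul_assoc, hW,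
            Matrix.mul_one]
  exact_mod_cast h

/-- **Schur's lemma**: a matrix that commutes with an irreducible family is a scalar. -/
theorem IsIrreducible.eq_smul_one {G : Type*} [Nonempty n] {U : G → unitary (Matrix n n ℂ)}
    (hU : IsIrreducible U) {X : Matrix n n ℂ}
    (hX : ∀ g, (U g : Matrix n n ℂ) * X = X * (U g : Matrix n n ℂ)) :
    ∃ c : ℂ, X = c • (1 : Matrix n n ℂ) := by
  obtain ⟨c, hc⟩ := Module.End.exists_eigenvalue (Matrix.toLin' X)
  refine ⟨c, ?_⟩
  have htop : Module.End.eigenspace (Matrix.toLin' X) c = ⊤ := by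
    refine (hU _ fun g v hv => ?_).resolve_left hc
    rw [Module.End.mem_eigenspace_iff, Matrix.toLin'_apply] at hv ⊢
    rw [Matrix.mulVec_mulVec, ← hX, ← Matrix.mulVec_mulVec, hv, Matrix.mulVec_smul]
  refine Matrix.ext_of_mulVec_single fun i => ?_
  have := (htop ▸ Submodule.mem_top :
    Pi.single i (1 : ℂ) ∈ Module.End.eigenspace (Matrix.toLin' X) c)
  rw [Module.End.mem_eigenspace_iff, Matrix.toLin'_apply] at this
  rw [this, Matrix.smul_mulVec, Matrix.one_mulVec]

/-- The maximally mixed state is a limit of convex combinations of the pure states of an orbit: the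
element of least Hilbert–Schmidt norm of the closed convex hull of the orbit is unique, hence
invariant, hence a scalar by Schur's lemma. -/
theorem maximallyMixed_mem_closure_convexHull {G : Type*} [Group G] [Nonempty n]
    {U : G → unitary (Matrix n n ℂ)} (hrep : IsProjectiveRep U) (hU : IsIrreducible U)
    {Z : Matrix n n ℂ} (hZ : Z.trace = 1) :
    (Fintype.card n : ℂ)⁻¹ • (1 : Matrix n n ℂ) ∈ closure (convexHull ℝ
      (Set.range fun g => (U g : Matrix n n ℂ) * Z * star (U g : Matrix n n ℂ))) := by
  set S := Set.range fun g => (U g : Matrix n n ℂ) * Z * star (U g : Matrix n n ℂ) with hS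
  set K := closure (convexHull ℝ S) with hK
  have hUU : ∀ g, star (U g : Matrix n n ℂ) * (U g : Matrix n n ℂ) = 1 := fun g =>
    (Unitary.mem_iff.1 (U g).2).1
  have hUU' : ∀ g, (U g : Matrix n n ℂ) * star (U g : Matrix n n ℂ) = 1 := fun g =>
    (Unitary.mem_iff.1 (U g).2).2
  have hconv : Convex ℝ K := (convex_convexHull ℝ S).closure
  have hne : K.Nonempty := ⟨_, subset_closure (subset_convexHull ℝ S ⟨1, rfl⟩)⟩
  -- conjugation by a group element, as a real-linear map
  set φ : G → Matrix n n ℂ →ₗ[ℝ] Matrix n n ℂ := fun g =>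
    LinearMap.mulRight ℝ (star (U g : Matrix n n ℂ)) ∘ₗ LinearMap.mulLeft ℝ (U g : Matrix n n ℂ)
    with hφ
  have hφ_apply : ∀ g X, φ g X = (U g : Matrix n n ℂ) * X * star (U g : Matrix n n ℂ) :=
    fun g X => rfl
  have hφ_cont : ∀ g, Continuous (φ g) := fun g =>
    (continuous_const.matrix_mul continuous_id).matrix_mul continuous_const
  have hSmaps : ∀ h, Set.MapsTo (φ h) S S := by
    rintro h _ ⟨g, rfl⟩
    refine ⟨h * g, ?_⟩
    obtain ⟨c, hc, hmul⟩ := hrep h g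
    have hcc : c * star c = 1 := by
      rw [Complex.star_def, Complex.mul_conj', hc]; simp
    -- the phase of the projective representation cancels
    have h1 : (U h : Matrix n n ℂ) * ((U g : Matrix n n ℂ) * Z * star (U g : Matrix n n ℂ)) *
        star (U h : Matrix n n ℂ) = ((U h : Matrix n n ℂ) * (U g : Matrix n n ℂ)) * Z *
          star ((U h : Matrix n n ℂ) * (U g : Matrix n n ℂ)) := by
      rw [star_mul]; simp only [Matrix.mul_assoc]
    rw [hφ_apply, h1, hmul, star_smul]
    simp only [Matrix.smul_mul, Matrix.mul_smul, smul_smul]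
    rw [mul_comm, hcc, one_smul]
  have hKmaps : ∀ h, Set.MapsTo (φ h) K K := by
    intro h
    refine Set.MapsTo.closure ?_ (hφ_cont h)
    rw [Set.mapsTo_iff_image_subset, (φ h).image_convexHull]
    exact convexHull_mono (hSmaps h).image_subset
  -- the trace and a bound on the entries pass from the orbit to the closed convex hull
  have htr : ∀ X ∈ K, X.trace = 1 := by
    have hcl : IsClosed {X : Matrix n n ℂ | X.trace = 1} :=
      isClosed_eq continuous_id.matrix_trace continuous_const
    have hcv : Convex ℝ {X : Matrix n n ℂ | X.trace = 1} := by
      intro X hX Y hY a b _ _ hab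
      simp only [Set.mem_ofPred_eq] at hX hY ⊢
      rw [Matrix.trace_add, Matrix.trace_smul, Matrix.trace_smul, hX, hY, ← add_smul, hab, one_smul]
    refine fun X hX => closure_minimal (convexHull_min ?_ hcv) hcl hX
    rintro _ ⟨g, rfl⟩
    change Matrix.trace _ = 1
    rw [Matrix.trace_mul_comm, ← Matrix.mul_assoc, hUU, Matrix.one_mul, hZ]
  have hcompact : IsCompact K := by
    set B : Set (Matrix n n ℂ) := Set.univ.pi fun _ => Set.univ.pi fun _ =>
      Metric.closedBall (0 : ℂ) √(hsNormSq Z) with hB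
    have hBc : IsCompact B := isCompact_univ_pi fun _ => isCompact_univ_pi fun _ =>
      isCompact_closedBall _ _
    have hBv : Convex ℝ B := convex_pi fun _ _ => convex_pi fun _ _ => convex_closedBall _ _
    refine hBc.of_isClosed_subset isClosed_closure
      (closure_minimal (convexHull_min ?_ hBv) hBc.isClosed)
    rintro _ ⟨g, rfl⟩ a _ b _
    rw [mem_closedBall_zero_iff, ← hsNormSq_unitary_conj (hUU g) Z]
    exact Real.le_sqrt_of_sq_le (sq_norm_apply_le_hsNormSq _ a b)
  have hcont : Continuous (hsNormSq : Matrix n n ℂ → ℝ) := by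
    refine continuous_finsetSum _ fun a _ => continuous_finsetSum _ fun b _ => ?_
    exact ((continuous_apply_apply a b).norm).pow 2
  obtain ⟨X, hXK, hXmin⟩ := hcompact.exists_isMinOn hne hcont.continuousOn
  have hXinv : ∀ g, φ g X = X := by
    intro g
    have h1 : hsNormSq (φ g X) = hsNormSq X := hsNormSq_unitary_conj (hUU g) X
    have h2 : hsNormSq X ≤ hsNormSq ((2⁻¹ : ℝ) • φ g X + (2⁻¹ : ℝ) • X) :=
      hXmin (hconv (hKmaps g hXK) hXK (by norm_num) (by norm_num) (by norm_num))
    rw [hsNormSq_midpoint, h1] at h2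
    have h3 : hsNormSq (φ g X - X) ≤ 0 := by linarith
    ext a b
    have h4 := (sq_norm_apply_le_hsNormSq (φ g X - X) a b).trans h3
    have h5 : ‖(φ g X - X) a b‖ = 0 := pow_eq_zero_iff two_ne_zero |>.1
      (le_antisymm h4 (by positivity))
    exact sub_eq_zero.1 (norm_eq_zero.1 h5)
  have hXcomm : ∀ g, (U g : Matrix n n ℂ) * X = X * (U g : Matrix n n ℂ) := by
    intro g
    conv_rhs => rw [← hXinv g, hφ_apply, Matrix.mul_assoc, hUU, Matrix.mul_one]
  obtain ⟨c, hc⟩ := hU.eq_smul_one hXcomm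
  have hc1 : c = (Fintype.card n : ℂ)⁻¹ := by
    have := htr X hXK
    rw [hc, Matrix.trace_smul, Matrix.trace_one, smul_eq_mul] at this
    exact eq_inv_of_mul_eq_one_left this
  rw [← hc1, ← hc]
  exact hXK

/-- A Hermitian matrix with entries of total modulus at most `ε` is bounded below by `-ε I`. -/
theorem posSemidef_smul_one_add {Y : Matrix n n ℂ} (hY : Y.IsHermitian) {ε : ℝ}
    (h : ∑ a, ∑ b, ‖Y a b‖ ≤ ε) : ((ε : ℂ) • (1 : Matrix n n ℂ) + Y).PosSemidef := by
  have hherm : ((ε : ℂ) • (1 : Matrix n n ℂ) + Y).IsHermitian := by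
    refine Matrix.IsHermitian.add ?_ hY
    rw [Matrix.IsHermitian, Matrix.conjTranspose_smul, Matrix.conjTranspose_one]
    simp
  refine Matrix.PosSemidef.of_dotProduct_mulVec_nonneg hherm fun x => ?_
  have hquad : star x ⬝ᵥ (Y.mulVec x) = quadForm Y (WithLp.toLp 2 x) := by
    simp only [dotProduct, Matrix.mulVec, quadForm, Finset.mul_sum, mul_assoc]
    rfl
  have hone : star x ⬝ᵥ x = ((‖(WithLp.toLp 2 x : EuclideanSpace ℂ n)‖ ^ 2 : ℝ) : ℂ) := by
    rw [EuclideanSpace.norm_sq_eq, Complex.ofReal_sum]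
    refine Finset.sum_congr rfl fun a _ => ?_
    rw [Pi.star_apply, Complex.star_def, Complex.conj_mul', Complex.ofReal_pow]
  have him : (star x ⬝ᵥ (Y.mulVec x)).im = 0 := hY.im_star_dotProduct_mulVec_self x
  have hle : -(ε * ‖(WithLp.toLp 2 x : EuclideanSpace ℂ n)‖ ^ 2) ≤
      (star x ⬝ᵥ (Y.mulVec x)).re := by
    rw [hquad]
    have h1 := (abs_le.1 (Complex.abs_re_le_norm (quadForm Y (WithLp.toLp 2 x)))).1
    have h2 := norm_quadForm_le Y (WithLp.toLp 2 x)
    have h3 := mul_le_mul_of_nonneg_right h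
      (sq_nonneg ‖(WithLp.toLp 2 x : EuclideanSpace ℂ n)‖)
    linarith
  rw [Matrix.add_mulVec, Matrix.smul_mulVec, Matrix.one_mulVec, dotProduct_add, dotProduct_smul,
    hone, smul_eq_mul, ← Complex.ofReal_mul, Complex.nonneg_iff, Complex.add_re, Complex.add_im,
    Complex.ofReal_re, Complex.ofReal_im, him]
  exact ⟨by linarith, by simp⟩

/-- A resolution of `(1 + ε) I` into multiples of the pure states of an orbit and a remainder of
small trace. -/
theorem exists_resolution {G : Type*} [Group G] [Nonempty n]
    {U : G → unitary (Matrix n n ℂ)} (hrep : IsProjectiveRep U) (hU : IsIrreducible U)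
    {w : EuclideanSpace ℂ n} (hw : ‖w‖ = 1) {ε : ℝ} (hε : 0 < ε) :
    ∃ (J : Type) (_ : Fintype J) (g : J → G) (c : J → ℝ) (r : n → EuclideanSpace ℂ n),
      (∀ j, 0 ≤ c j) ∧ ∑ j, c j = Fintype.card n ∧ ∑ m, ‖r m‖ ^ 2 = ε * Fintype.card n ∧
      ∀ a b, (1 + ε : ℂ) * (1 : Matrix n n ℂ) a b =
        (∑ j, c j * ((U (g j) : Matrix n n ℂ).mulVec w a *
          star ((U (g j) : Matrix n n ℂ).mulVec w b))) + ∑ m, r m a * star (r m b) := by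
  set d : ℝ := ((Fintype.card n : ℕ) : ℝ) with hd
  have hd0 : 0 < d := by rw [hd]; exact_mod_cast Fintype.card_pos
  set Z : Matrix n n ℂ := Matrix.vecMulVec w (star w) with hZ
  have hconj : ∀ g a b, ((U g : Matrix n n ℂ) * Z * star (U g : Matrix n n ℂ)) a b =
      (U g : Matrix n n ℂ).mulVec w a * star ((U g : Matrix n n ℂ).mulVec w b) := by
    intro g a b
    rw [hZ, Matrix.mul_vecMulVec, Matrix.vecMulVec_mul, Matrix.vecMulVec_apply,
      Matrix.star_eq_conjTranspose, ← Matrix.star_mulVec]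
    rfl
  have hZtr : Z.trace = 1 := by
    have h1 : Z.trace = ((‖w‖ ^ 2 : ℝ) : ℂ) := by
      rw [EuclideanSpace.norm_sq_eq, Complex.ofReal_sum]
      refine Finset.sum_congr rfl fun a _ => ?_
      rw [Complex.ofReal_pow, ← Complex.mul_conj']
      rfl
    rw [h1, hw]; simp
  have hmem := maximallyMixed_mem_closure_convexHull hrep hU hZtr
  -- `d²` entries of `I - d E`, each at most `d δ` in modulus, have total modulus at most `ε`
  set δ : ℝ := ε / (d * d * d) with hδ
  have hδ0 : 0 < δ := by positivity
  set O : Set (Matrix n n ℂ) :=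
    {Y | ∀ a b, ‖Y a b - ((Fintype.card n : ℂ)⁻¹ • (1 : Matrix n n ℂ)) a b‖ < δ} with hO
  have hOo : IsOpen O := by
    simp only [hO, Set.ofPred_forall]
    refine isOpen_iInter_of_finite fun a => isOpen_iInter_of_finite fun b => ?_
    exact isOpen_lt (((continuous_apply_apply a b).sub continuous_const).norm) continuous_const
  obtain ⟨E, hEO, hE⟩ := mem_closure_iff.1 hmem O hOo fun a b => by simpa using hδ0
  obtain ⟨J, hJ, c, z, hc0, hc1, hz, hcz⟩ := mem_convexHull_iff_exists_fintype.1 hE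
  choose g hg using hz
  have hEab : ∀ a b, (∑ j, ((d * c j : ℝ) : ℂ) * ((U (g j) : Matrix n n ℂ).mulVec w a *
      star ((U (g j) : Matrix n n ℂ).mulVec w b))) = d * E a b := by
    intro a b
    rw [← hcz, Matrix.sum_apply, Finset.mul_sum]
    refine Finset.sum_congr rfl fun j _ => ?_
    rw [Matrix.smul_apply, ← hg j]
    change _ = (d : ℂ) * (c j • ((U (g j) : Matrix n n ℂ) * Z * star (U (g j) : Matrix n n ℂ)) a b)
    rw [hconj, Complex.real_smul, Complex.ofReal_mul, mul_assoc]
  set Y : Matrix n n ℂ := 1 - (d : ℂ) • E with hY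
  have hEherm : E.IsHermitian := by
    ext a b
    have hdc : (d : ℂ) ≠ 0 := Complex.ofReal_ne_zero.2 hd0.ne'
    refine mul_left_cancel₀ hdc ?_
    have h1 : (d : ℂ) * star (E b a) = star (d * E b a) := by
      rw [star_mul', Complex.star_def, Complex.conj_ofReal]
    rw [Matrix.conjTranspose_apply, h1, ← hEab, ← hEab, star_sum]
    refine Finset.sum_congr rfl fun j _ => ?_
    simp only [star_mul', Complex.star_def, Complex.conj_ofReal, Complex.conj_conj]
    ring
  have hYherm : Y.IsHermitian := by
    refine Matrix.isHermitian_one.sub ?_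
    rw [Matrix.IsHermitian, Matrix.conjTranspose_smul, hEherm.eq]
    simp
  have hYab : ∀ a b, ‖Y a b‖ ≤ d * δ := by
    intro a b
    have h1 : Y a b = -(d * (E a b - ((Fintype.card n : ℂ)⁻¹ • (1 : Matrix n n ℂ)) a b)) := by
      have hdc : (Fintype.card n : ℂ) ≠ 0 := by exact_mod_cast Fintype.card_ne_zero
      rw [hY, hd]
      simp only [Matrix.sub_apply, Matrix.smul_apply, smul_eq_mul, Complex.ofReal_natCast]
      field_simp
      ring
    rw [h1, norm_neg, norm_mul, Complex.norm_real, Real.norm_of_nonneg hd0.le]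
    exact mul_le_mul_of_nonneg_left (hEO a b).le hd0.le
  have hYsum : ∑ a, ∑ b, ‖Y a b‖ ≤ ε := by
    calc ∑ a, ∑ b, ‖Y a b‖ ≤ ∑ _a : n, ∑ _b : n, d * δ :=
          Finset.sum_le_sum fun a _ => Finset.sum_le_sum fun b _ => hYab a b
      _ = d * (d * (d * δ)) := by simp [hd]
      _ = ε := by rw [hδ]; field_simp
  obtain ⟨r, hr⟩ := (posSemidef_smul_one_add hYherm hYsum).exists_eq_sum
  have hEtr : E.trace = 1 := by
    rw [← hcz, Matrix.trace_sum]
    have h1 : ∀ j, (c j • z j).trace = c j := by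
      intro j
      rw [Matrix.trace_smul, ← hg j]
      rw [Matrix.trace_mul_comm, ← Matrix.mul_assoc, (Unitary.mem_iff.1 (U (g j)).2).1,
        Matrix.one_mul, hZtr, Complex.real_smul, mul_one]
    rw [Finset.sum_congr rfl fun j _ => h1 j, ← Complex.ofReal_sum, hc1, Complex.ofReal_one]
  refine ⟨J, hJ, g, fun j => d * c j, r, fun j => mul_nonneg hd0.le (hc0 j), ?_, ?_, ?_⟩
  · rw [← Finset.mul_sum, hc1, mul_one]
  · rw [← re_trace_eq_sum_normSq hr, hY, Matrix.trace_add, Matrix.trace_sub, Matrix.trace_smul,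
      Matrix.trace_smul, hEtr, Matrix.trace_one]
    simp [hd]
  · intro a b
    rw [hEab, ← hr, hY]
    simp only [Matrix.add_apply, Matrix.sub_apply, Matrix.smul_apply, smul_eq_mul]
    ring

end

/-! ### Benchmarks -/

section

variable {n ι κ G : Type*} [Fintype n] [DecidableEq n] [Group G]

/-- An input system of dimension zero carries no state of trace one. -/
theorem Test.nonempty_input {n ι κ : Type*} (T : Test n ι κ) : Nonempty n := by
  by_contra hn
  rw [not_nonempty_iff] at hn
  exact zero_ne_one (hasSum_empty.unique T.σ_density.2)

/-- The covariant device built from a product vector `u ⊗ w`: it measures the orbit of `w` and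
prepares the corresponding element of the orbit of `u`. As `ε → 0`, its score
approaches `d ⟨u ⊗ w| Ω |u ⊗ w⟩`, since every outcome contributes in proportion to this value by covariance. -/
theorem exists_channel_score_ge [Nonempty ι] [Nonempty n] {U' : G → unitary (Op ι)}
    {U : G → unitary (Matrix n n ℂ)} (hrep : IsProjectiveRep U) (hirr : IsIrreducible U)
    (T : Test n ι κ) (hcov : IsCovariant T.performanceOperator U' U) {u : Hil ι} (hu : ‖u‖ = 1)
    {w : EuclideanSpace ℂ n} (hw : ‖w‖ = 1) {ε : ℝ} (hε : 0 < ε) :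
    ∃ C : Matrix n n ℂ →ₗ[ℂ] Op ι, IsMPChannel C ∧
      Fintype.card n * (T.expect u w).re - ε * (Fintype.card n * T.bound) ≤
        (1 + ε) * T.score C := by
  obtain ⟨J, hJ, g, c, r, hc, hcsum, hrsum, hres⟩ := exists_resolution hrep hirr hw hε
  have hε1 : 0 < 1 + ε := by positivity
  set s : ℝ := (1 + ε)⁻¹ with hs
  have hs0 : 0 ≤ s := by positivity
  have hsq : ∀ x : ℝ, 0 ≤ x → ((√x : ℝ) : ℂ) * ((√x : ℝ) : ℂ) = x := fun x hx => by
    rw [← Complex.ofReal_mul, Real.mul_self_sqrt hx]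
  have hsqn : ∀ x : ℝ, 0 ≤ x → ‖((√x : ℝ) : ℂ)‖ ^ 2 = x := fun x hx => by
    rw [Complex.norm_real, Real.norm_of_nonneg (Real.sqrt_nonneg x), Real.sq_sqrt hx]
  -- the outcomes in `J` come from the orbit, those in `n` from the remainder
  set y : J ⊕ n → Hil ι := Sum.elim (fun j => (U' (g j) : Op ι) u) fun _ => u with hy
  set z : J ⊕ n → EuclideanSpace ℂ n :=
    Sum.elim (fun j => ((√(s * c j) : ℝ) : ℂ) • WithLp.toLp 2 ((U (g j) : Matrix n n ℂ).mulVec w))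
      (fun m => ((√s : ℝ) : ℂ) • r m) with hz
  have hy1 : ∀ j, ‖y j‖ = 1 := by
    rintro (j | m)
    · have h1 : inner ℂ ((U' (g j) : Op ι) u) ((U' (g j) : Op ι) u) = inner ℂ u u := by
        rw [← ContinuousLinearMap.adjoint_inner_right, ← ContinuousLinearMap.star_eq_adjoint,
          ← mul_apply_eq_comp, (Unitary.mem_iff.1 (U' (g j)).2).1, one_apply_eq_self]
      rw [inner_self_eq_norm_sq_to_K, inner_self_eq_norm_sq_to_K, hu] at h1
      have h2 : ‖(U' (g j) : Op ι) u‖ ^ 2 = 1 ^ 2 := by exact_mod_cast h1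
      exact (pow_left_inj₀ (norm_nonneg _) zero_le_one two_ne_zero).1 h2
    · exact hu
  have hE : ∀ a b, (1 : Matrix n n ℂ) a b = ∑ j, z j a * star (z j b) := by
    intro a b
    have h1 : (1 : Matrix n n ℂ) a b = (s : ℂ) * ((1 + ε : ℂ) * (1 : Matrix n n ℂ) a b) := by
      rw [← mul_assoc, hs]
      have : ((1 + ε : ℝ) : ℂ) ≠ 0 := Complex.ofReal_ne_zero.2 hε1.ne'
      push_cast at this ⊢
      rw [inv_mul_cancel₀ this, one_mul]
    rw [h1, hres, Fintype.sum_sum_type, mul_add, Finset.mul_sum, Finset.mul_sum]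
    congr 1
    · refine Finset.sum_congr rfl fun j _ => ?_
      simp only [hz, Sum.elim_inl, PiLp.smul_apply, smul_eq_mul, star_mul', Complex.star_def,
        Complex.conj_ofReal]
      rw [mul_mul_mul_comm, hsq _ (mul_nonneg hs0 (hc j)), Complex.ofReal_mul, mul_assoc]
    · refine Finset.sum_congr rfl fun m _ => ?_
      simp only [hz, Sum.elim_inr, PiLp.smul_apply, smul_eq_mul, star_mul', Complex.star_def,
        Complex.conj_ofReal]
      rw [mul_mul_mul_comm, hsq _ hs0]
  obtain ⟨C, hC, hscore⟩ := exists_pure_device hy1 hE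
  refine ⟨C, hC, ?_⟩
  have hleft : ∀ j, (T.expect (y (Sum.inl j)) (z (Sum.inl j))).re =
      s * c j * (T.expect u w).re := by
    intro j
    have h1 := T.expect_smul 1 ((√(s * c j) : ℝ) : ℂ) ((U' (g j) : Op ι) u)
      (WithLp.toLp 2 ((U (g j) : Matrix n n ℂ).mulVec w))
    rw [one_smul, T.expect_covariant _ _ (hcov (g j)), hsqn _ (mul_nonneg hs0 (hc j))] at h1
    change (T.expect ((U' (g j) : Op ι) u) (((√(s * c j) : ℝ) : ℂ) •
      WithLp.toLp 2 ((U (g j) : Matrix n n ℂ).mulVec w))).re = _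
    rw [h1, Complex.re_ofReal_mul]
    simp
  have hright : ∀ m, -(T.bound * (s * ‖r m‖ ^ 2)) ≤
      (T.expect (y (Sum.inr m)) (z (Sum.inr m))).re := by
    intro m
    have h1 := T.norm_expect_le u (((√s : ℝ) : ℂ) • r m)
    rw [hu, norm_smul, mul_pow, hsqn _ hs0, one_pow, one_mul] at h1
    exact (abs_le.1 ((Complex.abs_re_le_norm _).trans h1)).1
  have hsum : s * (Fintype.card n * (T.expect u w).re - ε * (Fintype.card n * T.bound)) ≤
      T.score C := by
    rw [hscore, Fintype.sum_sum_type, Finset.sum_congr rfl fun j _ => hleft j]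
    have h1 := Finset.sum_le_sum fun m (_ : m ∈ Finset.univ) => hright m
    rw [Finset.sum_neg_distrib, ← Finset.mul_sum, ← Finset.mul_sum, hrsum] at h1
    rw [← Finset.sum_mul, ← Finset.mul_sum, hcsum]
    linarith
  rwa [hs, inv_mul_le_iff₀ hε1] at hsum

theorem Test.isDetBenchmark [Nonempty ι] {U' : G → unitary (Op ι)}
    {U : G → unitary (Matrix n n ℂ)} (hrep : IsProjectiveRep U) (hirr : IsIrreducible U)
    (T : Test n ι κ) (hcov : IsCovariant T.performanceOperator U' U) :
    T.IsDetBenchmark ((Fintype.card n : ℝ) * productNumericalRange T.performanceOperator) := by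
  have := T.nonempty_input
  have hd0 : (0 : ℝ) < Fintype.card n := by exact_mod_cast Fintype.card_pos
  constructor
  · rintro _ ⟨C, hC, rfl⟩
    simpa using MeasuresAndPrepares.score_le hC T
  · intro M hM
    rw [← le_div_iff₀' hd0]
    refine csSup_le ?_ ?_
    · exact ⟨_, ket (Classical.arbitrary ι), EuclideanSpace.single (Classical.arbitrary n) 1,
        norm_ket _, by simp, rfl⟩
    · rintro _ ⟨u, w, hu, hw, rfl⟩
      rw [T.productExpectation_eq_re_expect, le_div_iff₀' hd0]
      -- let the trace `ε` of the remainder in the resolution of the identity tend to zero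
      have hlim : Filter.Tendsto (fun ε : ℝ => (1 + ε) * M + ε * (Fintype.card n * T.bound))
          (nhdsWithin 0 (Set.Ioi 0)) (nhds M) := by
        have h1 : Continuous fun ε : ℝ => (1 + ε) * M + ε * (Fintype.card n * T.bound) := by
          fun_prop
        have h2 := (h1.tendsto 0).mono_left (nhdsWithin_le_nhds (s := Set.Ioi (0 : ℝ)))
        simpa using h2
      refine ge_of_tendsto hlim (eventually_nhdsWithin_of_forall fun ε hε => ?_)
      obtain ⟨C, hC, hle⟩ := exists_channel_score_ge hrep hirr T hcov hu hw hε
      have h1 : T.score C ≤ M := hM ⟨C, hC, rfl⟩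
      have h2 : (0 : ℝ) < 1 + ε := add_pos one_pos hε
      nlinarith [mul_le_mul_of_nonneg_left h1 h2.le]

theorem Test.score_smul {n : Type*} (T : Test n ι κ) (p : ℝ) (C : Matrix n n ℂ →ₗ[ℂ] Op ι) :
    T.score ((p : ℂ) • C) = p * T.score C := by
  have h : traceMul (mat T.O) (applyLeft ((p : ℂ) • C) T.σ) =
      p * traceMul (mat T.O) (applyLeft C T.σ) := by
    have happ : ∀ q r, applyLeft ((p : ℂ) • C) T.σ q r = p * applyLeft C T.σ q r := fun q r =>
      mat_smul _ _ _ _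
    simp only [traceMul, happ, mul_left_comm _ (p : ℂ), tsum_mul_left]
  rw [score, h, Complex.re_ofReal_mul, score]

theorem MeasuresAndPrepares.smul {E : Matrix n n ℂ} {C : Matrix n n ℂ →ₗ[ℂ] Op ι}
    (h : MeasuresAndPrepares E C) {p : ℝ} (hp : 0 ≤ p) :
    MeasuresAndPrepares ((p : ℂ) • E) ((p : ℂ) • C) := by
  obtain ⟨P, ρ, hP, hPE, hρ, hC⟩ := h
  refine ⟨fun k => (p : ℂ) • P k, ρ, fun k => (hP k).smul (by exact_mod_cast hp),
    hPE.const_smul _, hρ, fun X => ?_⟩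
  have := (hC X).const_smul (p : ℂ)
  simpa [smul_smul, Matrix.smul_mul, Matrix.trace_smul] using this

theorem MeasuresAndPrepares.successProb_eq {E : Matrix n n ℂ} {C : Matrix n n ℂ →ₗ[ℂ] Op ι}
    (h : MeasuresAndPrepares E C) (T : Test n ι κ)
    (hT : T.marginal = (Fintype.card n : ℂ)⁻¹ • (1 : Matrix n n ℂ)) :
    T.successProb C = (Fintype.card n : ℝ)⁻¹ * E.trace.re := by
  rw [Test.successProb, hT, map_smul]
  simp only [mat_smul, tsum_mul_left]
  rw [← h.tsum_mat_one, ← Complex.re_ofReal_mul]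
  push_cast
  rfl

/-- For a maximally mixed marginal, the score of an operation that measures `E` and succeeds with
probability `p = Tr E / d` is at most `Λ Tr E = p d Λ`, and scaling a channel by `p` gives an
operation with success probability `p` and the same conditional score. -/
theorem Test.IsDetBenchmark.isFullyBlackBox {T : Test n ι κ}
    (h : T.IsDetBenchmark ((Fintype.card n : ℝ) * productNumericalRange T.performanceOperator))
    (hT : T.marginal = (Fintype.card n : ℂ)⁻¹ • (1 : Matrix n n ℂ)) : T.IsFullyBlackBox := by
  have := T.nonempty_input
  have hd0 : (0 : ℝ) < Fintype.card n := by exact_mod_cast Fintype.card_pos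
  refine ⟨_, h, fun p hp hp1 => ⟨?_, fun M hM => h.2 ?_⟩⟩
  · rintro _ ⟨C, ⟨E, _, hC⟩, hsucc, rfl⟩
    have h1 := hC.score_le T
    rw [hC.successProb_eq T hT] at hsucc
    have h2 : E.trace.re = p * Fintype.card n := by
      rw [← hsucc]; field_simp
    rw [Test.probScore, hC.successProb_eq T hT, hsucc, div_le_iff₀ hp]
    rw [h2] at h1
    linarith
  · rintro _ ⟨C, hC, rfl⟩
    have hC' : MeasuresAndPrepares 1 C := hC
    have hpC := hC'.smul hp.le
    have hsucc : T.successProb ((p : ℂ) • C) = p := by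
      rw [hpC.successProb_eq T hT, Matrix.trace_smul, Matrix.trace_one]
      simp [hd0.ne', mul_comm p]
    refine hM ⟨(p : ℂ) • C, ⟨_, ?_, hpC⟩, hsucc, ?_⟩
    · have h1 : (1 : Matrix n n ℂ) - (p : ℂ) • 1 = ((1 - p : ℝ) : ℂ) • (1 : Matrix n n ℂ) := by
        push_cast
        rw [sub_smul, one_smul]
      rw [h1]
      exact Matrix.PosSemidef.one.smul (by exact_mod_cast sub_nonneg.2 hp1)
    · rw [Test.probScore, hsucc, Test.score_smul, mul_div_cancel_left₀ _ hp.ne']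

end

end QBenchmark

theorem lemma3 {n : Type*} {ι : Type*} {κ : Type*} {G : Type*}
    [Fintype n] [DecidableEq n] [Nonempty ι] [Group G]
    (U' : G → unitary (QBenchmark.Op ι)) (U : G → unitary (Matrix n n ℂ))
    (hU' : QBenchmark.IsProjectiveRep U') (hU : QBenchmark.IsProjectiveRep U)
    (hirr : QBenchmark.IsIrreducible U)
    (T : QBenchmark.Test n ι κ)
    (hppt : QBenchmark.IsPPT T.performanceOperator)
    (hcov : QBenchmark.IsCovariant T.performanceOperator U' U) :
    T.IsDetBenchmark
      ((Fintype.card n : ℝ) * QBenchmark.productNumericalRange T.performanceOperator) ∧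
    ∀ (κ' : Type*) (T' : QBenchmark.Test n ι κ'),
      T'.performanceOperator = T.performanceOperator →
      T'.marginal = (Fintype.card n : ℂ)⁻¹ • (1 : Matrix n n ℂ) →
      T'.IsFullyBlackBox := by
  refine ⟨T.isDetBenchmark hU hirr hcov, fun κ' T' hΩ hmarg => ?_⟩
  rw [← hΩ] at hcov
  exact (T'.isDetBenchmark hU hirr hcov).isFullyBlackBox hmarg
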